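/- Let $p$ be a prime and let $G$ be a finite $p$-group that is $2$-tuple regular, i.e. such that for all pairs $(g_1,g_2),(h_1,h_2)\in G^2$ for which the assignment $g_1\mapsto h_1,\ g_2\mapsto h_2$ defines an isomorphism $\langle g_1,g_2\rangle\to\langle h_1,h_2\rangle$, there is a bijection $\Psi\colon G\to G$ such that for every $g\in G$ the assignment $g_1\mapsto h_1,\ g_2\mapsto h_2,\ g\mapsto\Psi(g)$ defines an isomorphism $\langle g_1,g_2,g\rangle\to\langle h_1,h_2,\Psi(g)\rangle$. Then one of the following holds: (i) $G$ is homocyclic, i.e. $G$ is isomorphic to a direct product of $k$ copies of the cyclic group $C_{p^{\ell}}$ for some integers $k,\ell\ge 0$ (so the trivial group counts as homocyclic); (ii) $G$ is isomorphic to the quaternion group $Q_8$ of order $8$; (iii) $G$ is isomorphic to the Suzuki $2$-group $G_{64}$ of order $64$, i.e. to a Sylow $2$-subgroup of $\mathrm{PSU}(3,4)$; explicitly, $G_{64}$ is the group of all matrices $$\begin{pmatrix}1&a&b\\0&1&a^4\\0&0&1\end{pmatrix},\qquad a,b\in\mathbb{F}_{16},\quad b+b^4=a^5 .$$ -/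

import Mathlib

/-- The assignment `g i ↦ h i` defines an isomorphism between the subgroups generated by the
two tuples. -/
def AssignmentDefinesIso {G : Type*} [Group G] {ι : Type*} (g h : ι → G) : Prop :=
  ∃ φ : Subgroup.closure (Set.range g) ≃* Subgroup.closure (Set.range h),
    ∀ i, φ ⟨g i, Subgroup.subset_closure (Set.mem_range_self i)⟩ =
      ⟨h i, Subgroup.subset_closure (Set.mem_range_self i)⟩

/-- `ℓ`-tuple regularity: for all `ℓ`-tuples `g`, `h` for which `g i ↦ h i` defines an
isomorphism of the generated subgroups, there is a bijection `Ψ` of `G` such that for every `x`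
the assignment extended by `x ↦ Ψ x` still defines an isomorphism of the generated subgroups. -/
def IsTupleRegular (ℓ : ℕ) (G : Type*) [Group G] : Prop :=
  ∀ g h : Fin ℓ → G, AssignmentDefinesIso g h →
    ∃ Ψ : G → G, Function.Bijective Ψ ∧
      ∀ x : G, AssignmentDefinesIso (Fin.snoc g x : Fin (ℓ + 1) → G) (Fin.snoc h (Ψ x))

/-- `G` is isomorphic to a direct product of `k` copies of the cyclic group of order `p ^ ℓ`
(for a nontrivial group necessarily `k, ℓ ≥ 1`; the trivial group is included). -/
def IsHomocyclic (p : ℕ) (G : Type*) [Group G] : Prop :=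
  ∃ k ℓ : ℕ, Nonempty (G ≃* (Fin k → Multiplicative (ZMod (p ^ ℓ))))

/-- The field with 16 elements. -/
abbrev F16 : Type := GaloisField 2 4

/-- The involutory automorphism `x ↦ x ^ 4` of the field with 16 elements. -/
noncomputable def conjF16 : F16 →+* F16 := iterateFrobenius F16 2 2

/-- The Gram matrix of a nondegenerate Hermitian form on `F16 ^ 3`. -/
noncomputable def gramJ : Matrix (Fin 3) (Fin 3) F16 := !![0, 0, 1; 0, 1, 0; 1, 0, 0]

/-- The group `SU(3, 4)`: the matrices of determinant one over `F16` that preserve the Hermitian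
form `gramJ`. Its centre consists of the scalars `c` with `c ^ 3 = c ^ 5 = 1`, so it is trivial
and `PSU(3, 4) = SU(3, 4)`. -/
noncomputable def SU34 : Subgroup (Matrix.SpecialLinearGroup (Fin 3) F16) where
  carrier := {A | ((A : Matrix (Fin 3) (Fin 3) F16).map conjF16).transpose * gramJ *
    (A : Matrix (Fin 3) (Fin 3) F16) = gramJ}
  one_mem' := by simp
  mul_mem' := by
    intro A B hA hB
    simp only [Set.mem_ofPred_eq, Matrix.SpecialLinearGroup.coe_mul, Matrix.map_mul,
      Matrix.transpose_mul] at hA hB ⊢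
    calc _ = (B.1.map conjF16).transpose * ((A.1.map conjF16).transpose * gramJ * A.1) * B.1 := by
          simp only [Matrix.mul_assoc]
      _ = gramJ := by rw [hA, hB]
  inv_mem' := by
    intro A hA
    simp only [Set.mem_ofPred_eq] at hA ⊢
    have h1 : A.1 * (A⁻¹).1 = 1 := by
      rw [← Matrix.SpecialLinearGroup.coe_mul, mul_inv_cancel, Matrix.SpecialLinearGroup.coe_one]
    have h2 : ((A⁻¹).1.map conjF16).transpose * (A.1.map conjF16).transpose = 1 := by
      rw [← Matrix.transpose_mul, ← Matrix.map_mul, h1]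
      simp
    calc _ = ((A⁻¹).1.map conjF16).transpose *
          ((A.1.map conjF16).transpose * gramJ * A.1) * (A⁻¹).1 := by rw [hA]
      _ = (((A⁻¹).1.map conjF16).transpose * (A.1.map conjF16).transpose) * gramJ *
          (A.1 * (A⁻¹).1) := by simp only [Matrix.mul_assoc]
      _ = gramJ := by rw [h1, h2]; simp

/-- The group of upper triangular matrices over `F16` with all diagonal entries equal to one. -/
noncomputable def unitriangular3 : Subgroup (Matrix.SpecialLinearGroup (Fin 3) F16) where
  carrier := {A | (∀ i, A i i = 1) ∧ ∀ i j, j < i → A i j = 0}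
  one_mem' := by
    refine ⟨fun i => by simp, fun i j h => ?_⟩
    simp [h.ne']
  mul_mem' := by
    intro A B hA hB
    obtain ⟨hA1, hA2⟩ := hA
    obtain ⟨hB1, hB2⟩ := hB
    refine ⟨fun i => ?_, fun i j h => ?_⟩
    · fin_cases i <;>
        simp [Matrix.mul_apply, Fin.sum_univ_three, hA1, hB1, hA2, hB2]
    · fin_cases i <;> fin_cases j <;>
        simp_all [Matrix.mul_apply, Fin.sum_univ_three]
  inv_mem' := by
    intro A hA
    obtain ⟨hA1, hA2⟩ := hA
    refine ⟨fun i => ?_, fun i j h => ?_⟩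
    · fin_cases i <;>
        simp [Matrix.SpecialLinearGroup.coe_inv, Matrix.adjugate_fin_three, hA1, hA2]
    · fin_cases i <;> fin_cases j <;>
        simp_all [Matrix.SpecialLinearGroup.coe_inv, Matrix.adjugate_fin_three]

/-- The Suzuki 2-group of order 64, realized as the unitriangular Sylow 2-subgroup of
`PSU(3, 4) = SU(3, 4)`: it consists of the 64 matrices with rows `(1, a, b)`, `(0, 1, a ^ 4)`,
`(0, 0, 1)`, where `a` and `b` in `F16` satisfy `b + b ^ 4 = a ^ 5`, and the order of `SU(3, 4)`
is `62400 = 64 * 975`. -/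
abbrev G64 : Type := (SU34 ⊓ unitriangular3 : Subgroup (Matrix.SpecialLinearGroup (Fin 3) F16))

/-! Regularity says that two pairs satisfying the same relations cannot be told apart by relations
with one further element; even the number of such further elements agrees. Applied to `(x, x)` and
`(y, y)`, it makes elements of equal order indistinguishable in this sense. A property of this kind
that passes to powers therefore passes from `x` to every `g` with `orderOf g ∣ orderOf x`. In
particular the centre `Z` is the solution set of `g ^ p ^ k = 1`, where `p ^ k` is its exponent. An
abelian `G` is homocyclic because all elements of order `p` have roots of the same degrees.

If `G` is nonabelian, the layer of solutions of `x ^ p ^ (k + 1) = 1` lies in the second centre and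
its commutators have trivial `p`-th power. If the `p ^ k`-th power map is multiplicative on the
layer, the layer is abelian (`commute_of_pow_mul`): otherwise commutation with some `x` would have
an image at least as large as that of the power map, and a strictly larger kernel. An abelian layer
is impossible (`not_commute`), mainly because the fibres of a power map do not fit into a
centralizer. The formula for `(x * y) ^ n` in class two makes the power map multiplicative unless `p
^ k = 2`. So `p = 2`, `k = 1`, and `G` has exponent four.

Now `Z` consists of the solutions of `g ^ 2 = 1`, and commutation with a noncentral `x` maps onto
`Z`. Squaring behaves like a quadratic map to `Z` whose polar form is the commutator. Counting pairs
with equal squares gives centralizers of order `|Z| ^ 2` and `|G| = |Z| ^ 3` (`card_eq`). Sorting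
the elements that invert `x` by their squares gives `|Z| ≤ 4`, unless all these squares equal `x ^
2`; in that case a subgroup of order `|Z| * (|Z| + 2)` forces `|Z| = 2`. For `|Z| = 2` the group is
`Q_8`. For `|Z| = 4`, commuting is transitive on noncentral elements, which determines all squares
and commutators of four generators (`exists_suzukiRelations`). The same relations hold in `G64`, and
a comparison inside the product of the two groups gives the isomorphism. -/

open scoped commutatorElement

/-- Two tuples have the same type if they satisfy the same relations. -/
def SameType {G ι : Type*} [Group G] (g h : ι → G) : Prop :=
  ∀ w : FreeGroup ι, FreeGroup.lift g w = 1 ↔ FreeGroup.lift h w = 1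

/-! ### Types of tuples and of commuting pairs. -/

section Types

variable {G : Type*} [Group G] {ι : Type*}

/-- The evaluation of words as a map onto the generated subgroup. -/
def liftClosure (g : ι → G) : FreeGroup ι →* Subgroup.closure (Set.range g) :=
  FreeGroup.lift fun i => ⟨g i, Subgroup.subset_closure (Set.mem_range_self i)⟩

@[simp] lemma liftClosure_of (g : ι → G) (i : ι) : liftClosure g (FreeGroup.of i) =
    ⟨g i, Subgroup.subset_closure (Set.mem_range_self i)⟩ := by
  simp [liftClosure]

lemma coe_liftClosure (g : ι → G) (w : FreeGroup ι) :
    (liftClosure g w : G) = FreeGroup.lift g w := by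
  have : (Subgroup.subtype _).comp (liftClosure g) = FreeGroup.lift g := by
    ext i; simp
  exact DFunLike.congr_fun this w

lemma liftClosure_surjective (g : ι → G) : Function.Surjective (liftClosure g) := by
  rintro ⟨x, hx⟩
  rw [← FreeGroup.range_lift_eq_closure] at hx
  obtain ⟨w, rfl⟩ := hx
  exact ⟨w, Subtype.ext (coe_liftClosure g w)⟩

lemma AssignmentDefinesIso.sameType {g h : ι → G} (H : AssignmentDefinesIso g h) :
    SameType g h := by
  obtain ⟨φ, hφ⟩ := H
  have key : φ.toMonoidHom.comp (liftClosure g) = liftClosure h := by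
    ext i; simp [hφ]
  intro w
  rw [← coe_liftClosure, ← coe_liftClosure, OneMemClass.coe_eq_one, OneMemClass.coe_eq_one,
    ← key]
  simp

lemma SameType.assignmentDefinesIso {g h : ι → G} (H : SameType g h) :
    AssignmentDefinesIso g h := by
  have hk : (liftClosure g).ker = (liftClosure h).ker := by
    ext w
    rw [MonoidHom.mem_ker, MonoidHom.mem_ker, ← OneMemClass.coe_eq_one,
      ← OneMemClass.coe_eq_one, coe_liftClosure, coe_liftClosure]
    exact H w
  let e₁ := QuotientGroup.quotientKerEquivOfSurjective _ (liftClosure_surjective g)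
  let e₂ := QuotientGroup.quotientKerEquivOfSurjective _ (liftClosure_surjective h)
  refine ⟨(e₁.symm.trans (QuotientGroup.quotientMulEquivOfEq hk)).trans e₂, fun i => ?_⟩
  have h1 : e₁ (QuotientGroup.mk (FreeGroup.of i)) =
      ⟨g i, Subgroup.subset_closure (Set.mem_range_self i)⟩ := liftClosure_of g i
  have h2 : e₂ (QuotientGroup.mk (FreeGroup.of i)) =
      ⟨h i, Subgroup.subset_closure (Set.mem_range_self i)⟩ := liftClosure_of h i
  rw [← h1, ← h2]
  simp

lemma IsTupleRegular.exists_bijective (hreg : IsTupleRegular 2 G) {a b a' b' : G}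
    (H : SameType ![a, b] ![a', b']) :
    ∃ Ψ : G → G, Function.Bijective Ψ ∧ ∀ x, SameType ![a, b, x] ![a', b', Ψ x] := by
  obtain ⟨Ψ, hΨ, hx⟩ := hreg _ _ H.assignmentDefinesIso
  refine ⟨Ψ, hΨ, fun x => ?_⟩
  have := (hx x).sameType
  have e : ∀ a b x : G, (Fin.snoc ![a, b] x : Fin 3 → G) = ![a, b, x] := by
    intro a b x
    ext i
    fin_cases i <;> simp [Fin.snoc]
  rwa [e, e] at this

/-- The exponents depend on the word alone, so the same `i` and `j` serve for both pairs when two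
types are compared. -/
lemma exists_lift_pair_eq (w : FreeGroup (Fin 2)) : ∃ i j : ℤ, ∀ a b : G, Commute a b →
    FreeGroup.lift ![a, b] w = a ^ i * b ^ j := by
  induction w using FreeGroup.induction_on with
  | C1 => exact ⟨0, 0, by simp⟩
  | of s =>
    fin_cases s
    · exact ⟨1, 0, by simp⟩
    · exact ⟨0, 1, by simp⟩
  | inv_of s hs =>
    obtain ⟨i, j, h⟩ := hs
    refine ⟨-i, -j, fun a b hab => ?_⟩
    rw [map_inv, h a b hab, (hab.zpow_zpow i j).eq]
    simp
  | mul x y hx hy =>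
    obtain ⟨i, j, h⟩ := hx
    obtain ⟨i', j', h'⟩ := hy
    refine ⟨i + i', j + j', fun a b hab => ?_⟩
    rw [map_mul, h a b hab, h' a b hab, zpow_add, zpow_add]
    have := (hab.zpow_zpow i' j).eq
    rw [mul_assoc, mul_assoc, ← mul_assoc (b ^ j), ← this, mul_assoc]

lemma sameType_diag {x y : G} (h : orderOf x = orderOf y) : SameType ![x, x] ![y, y] := by
  intro w
  obtain ⟨i, j, H⟩ := exists_lift_pair_eq (G := G) w
  rw [H _ _ (Commute.refl x), H _ _ (Commute.refl y), ← zpow_add, ← zpow_add,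
    ← orderOf_dvd_iff_zpow_eq_one, ← orderOf_dvd_iff_zpow_eq_one, h]

/-- As `z` has prime order and lies outside `⟨x⟩`, the two cyclic groups meet trivially. The
right-hand side does not mention `z`, so all such commuting `z` have the same type over `x`. -/
lemma zpow_mul_zpow_eq_one_iff {p : ℕ} (hp : p.Prime) {x z : G}
    (hz : z ^ p = 1) (hzx : z ∉ Subgroup.zpowers x) (i j : ℤ) :
    x ^ i * z ^ j = 1 ↔ x ^ i = 1 ∧ (p : ℤ) ∣ j := by
  have hord : orderOf z = p :=
    have := Fact.mk hp
    orderOf_eq_prime hz (fun h => hzx (h ▸ one_mem _))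
  constructor
  · intro h
    have hj : (p : ℤ) ∣ j := by
      by_contra hj
      have hmem : z ^ j ∈ Subgroup.zpowers x := by
        rw [← inv_eq_of_mul_eq_one_right h]
        exact inv_mem (Subgroup.zpow_mem_zpowers x i)
      have hc : IsCoprime (p : ℤ) j := (Nat.prime_iff_prime_int.mp hp).coprime_iff_not_dvd.mpr hj
      obtain ⟨u, v, huv⟩ := hc
      apply hzx
      have : z = (z ^ j) ^ v := by
        rw [← zpow_mul]
        have : z ^ (u * p + v * j) = z := by rw [huv, zpow_one]
        rw [zpow_add, mul_comm u, zpow_mul, zpow_natCast, hz, one_zpow, one_mul] at this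
        rw [mul_comm j, this]
      rw [this]
      exact zpow_mem hmem v
    refine ⟨?_, hj⟩
    rw [← hord, orderOf_dvd_iff_zpow_eq_one] at hj
    rwa [hj, mul_one] at h
  · rintro ⟨h1, h2⟩
    rw [← hord, orderOf_dvd_iff_zpow_eq_one] at h2
    rw [h1, h2, one_mul]

lemma sameType_pair {p : ℕ} (hp : p.Prime) {x z z' : G} (hxz : Commute x z) (hxz' : Commute x z')
    (hz : z ^ p = 1) (hz' : z' ^ p = 1) (hzx : z ∉ Subgroup.zpowers x)
    (hzx' : z' ∉ Subgroup.zpowers x) : SameType ![x, z] ![x, z'] := by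
  intro w
  obtain ⟨i, j, H⟩ := exists_lift_pair_eq (G := G) w
  rw [H _ _ hxz, H _ _ hxz', zpow_mul_zpow_eq_one_iff hp hz hzx,
    zpow_mul_zpow_eq_one_iff hp hz' hzx']

end Types

/-! ### Consequences of regularity for roots and commutators. -/

section Regular

variable {G : Type*} [Group G]

lemma IsTupleRegular.exists_bijective_of_orderOf_eq (hreg : IsTupleRegular 2 G) {x y : G}
    (h : orderOf x = orderOf y) :
    ∃ Ψ : G → G, Function.Bijective Ψ ∧ ∀ g, SameType ![x, x, g] ![y, y, Ψ g] :=
  hreg.exists_bijective (sameType_diag h)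

/-- Elements whose orders agree centralize, up to exponent `M`, the same amount of the solutions
of `x ^ N = 1`. -/
lemma IsTupleRegular.commutator_pow_eq_one (hreg : IsTupleRegular 2 G) (N M : ℕ) {g h : G}
    (hgh : orderOf g = orderOf h) (hg : ∀ x : G, x ^ N = 1 → ⁅g, x⁆ ^ M = 1) :
    ∀ x : G, x ^ N = 1 → ⁅h, x⁆ ^ M = 1 := by
  obtain ⟨Ψ, hΨ, H⟩ := hreg.exists_bijective_of_orderOf_eq hgh
  intro y hy
  obtain ⟨x, rfl⟩ := hΨ.2 y
  have h1 := H x (FreeGroup.of 2 ^ N)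
  have h2 := H x (⁅(FreeGroup.of 0 : FreeGroup (Fin 3)), FreeGroup.of 2⁆ ^ M)
  simp [map_commutatorElement] at h1 h2
  exact h2.1 (hg x (h1.2 hy))

lemma IsTupleRegular.exists_root (hreg : IsTupleRegular 2 G) (N : ℕ) {g h : G}
    (hgh : orderOf g = orderOf h) (hg : ∃ x, x ^ N = g) : ∃ x, x ^ N = h := by
  obtain ⟨Ψ, hΨ, H⟩ := hreg.exists_bijective_of_orderOf_eq hgh
  obtain ⟨x, rfl⟩ := hg
  have h1 := H x (FreeGroup.of 2 ^ N * (FreeGroup.of 0)⁻¹)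
  simp [mul_inv_eq_one] at h1
  exact ⟨_, h1⟩

lemma IsTupleRegular.card_roots (hreg : IsTupleRegular 2 G) (N : ℕ) {g h : G}
    (hgh : orderOf g = orderOf h) : Nat.card {x // x ^ N = g} = Nat.card {x // x ^ N = h} := by
  obtain ⟨Ψ, hΨ, H⟩ := hreg.exists_bijective_of_orderOf_eq hgh
  refine Nat.card_congr ((Equiv.ofBijective Ψ hΨ).subtypeEquiv fun x => ?_)
  have h1 := H x (FreeGroup.of 2 ^ N * (FreeGroup.of 0)⁻¹)
  simpa [mul_inv_eq_one] using h1

/-- The commutators `⁅x, g⁆` with `g ^ N = 1` do not distinguish the central elements of order `p`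
outside the subgroup generated by `x`. -/
lemma IsTupleRegular.exists_commutator_eq (hreg : IsTupleRegular 2 G) {p : ℕ} (hp : p.Prime)
    (N : ℕ) {x z z' : G} (hxz : Commute x z) (hxz' : Commute x z')
    (hz : z ^ p = 1) (hz' : z' ^ p = 1) (hzx : z ∉ Subgroup.zpowers x)
    (hzx' : z' ∉ Subgroup.zpowers x) (h : ∃ g, g ^ N = 1 ∧ ⁅x, g⁆ = z) :
    ∃ g, g ^ N = 1 ∧ ⁅x, g⁆ = z' := by
  obtain ⟨Ψ, hΨ, H⟩ := hreg.exists_bijective (sameType_pair hp hxz hxz' hz hz' hzx hzx')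
  obtain ⟨g, hg, hgz⟩ := h
  have h1 := H g (FreeGroup.of 2 ^ N)
  have h2 := H g (⁅(FreeGroup.of 0 : FreeGroup (Fin 3)), FreeGroup.of 2⁆ * (FreeGroup.of 1)⁻¹)
  simp [map_commutatorElement, mul_inv_eq_one] at h1 h2
  exact ⟨Ψ g, h1.1 hg, h2.1 hgz⟩

/-- The number of `g` inverting `x` with a given central square of order two outside the subgroup
generated by `x` does not depend on the square. -/
lemma IsTupleRegular.card_commutator_sq (hreg : IsTupleRegular 2 G) {x z z' : G}
    (hxz : Commute x z) (hxz' : Commute x z')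
    (hz : z ^ 2 = 1) (hz' : z' ^ 2 = 1) (hzx : z ∉ Subgroup.zpowers x)
    (hzx' : z' ∉ Subgroup.zpowers x) :
    Nat.card {g // ⁅x, g⁆ = x ^ 2 ∧ g ^ 2 = z} = Nat.card {g // ⁅x, g⁆ = x ^ 2 ∧ g ^ 2 = z'} := by
  obtain ⟨Ψ, hΨ, H⟩ :=
    hreg.exists_bijective (sameType_pair Nat.prime_two hxz hxz' hz hz' hzx hzx')
  refine Nat.card_congr ((Equiv.ofBijective Ψ hΨ).subtypeEquiv fun g => ?_)
  have h1 := H g (FreeGroup.of 2 ^ 2 * (FreeGroup.of 1)⁻¹)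
  have h2 := H g (⁅(FreeGroup.of 0 : FreeGroup (Fin 3)), FreeGroup.of 2⁆ * (FreeGroup.of 0 ^ 2)⁻¹)
  simp [map_commutatorElement, mul_inv_eq_one] at h1 h2
  simp [h1, h2]

end Regular

/-- A suitable power of `x` has exactly the order of `g`. -/
lemma of_orderOf_dvd {G : Type*} [Group G] [Finite G] {S : G → Prop}
    (hS : ∀ g h, orderOf g = orderOf h → S g → S h) (hpow : ∀ g (n : ℕ), S g → S (g ^ n)) {x g : G}
    (hx : S x) (hd : orderOf g ∣ orderOf x) : S g :=
  hS _ _ (orderOf_pow_orderOf_div (orderOf_pos x).ne' hd) (hpow _ _ hx)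

/-! ### Commutator calculus with central commutators. -/

section CentralCommutators

variable {G : Type*} [Group G]

lemma commutator_mul_left_of_mem_center {x y g : G} (h : ⁅y, g⁆ ∈ Subgroup.center G) :
    ⁅x * y, g⁆ = ⁅x, g⁆ * ⁅y, g⁆ := by
  have h1 : ⁅x * y, g⁆ = x * ⁅y, g⁆ * x⁻¹ * ⁅x, g⁆ := by simp [commutatorElement_def]; group
  rw [h1, Subgroup.mem_center_iff.mp h x, mul_inv_cancel_right, Subgroup.mem_center_iff.mp h]

lemma commutator_mul_right_of_mem_center {x g h : G} (hc : ⁅x, h⁆ ∈ Subgroup.center G) :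
    ⁅x, g * h⁆ = ⁅x, g⁆ * ⁅x, h⁆ := by
  have h1 : ⁅x, g * h⁆ = ⁅x, g⁆ * (g * ⁅x, h⁆ * g⁻¹) := by simp [commutatorElement_def]; group
  rw [h1, Subgroup.mem_center_iff.mp hc g, mul_inv_cancel_right]

lemma commutator_pow_left_of_mem_center {x g : G} (h : ⁅x, g⁆ ∈ Subgroup.center G) (n : ℕ) :
    ⁅x ^ n, g⁆ = ⁅x, g⁆ ^ n := by
  induction n with
  | zero => simp
  | succ n ih => rw [pow_succ, commutator_mul_left_of_mem_center h, ih, pow_succ]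

lemma commutator_pow_right_of_mem_center {x g : G} (h : ⁅x, g⁆ ∈ Subgroup.center G) (n : ℕ) :
    ⁅x, g ^ n⁆ = ⁅x, g⁆ ^ n := by
  induction n with
  | zero => simp
  | succ n ih => rw [pow_succ, commutator_mul_right_of_mem_center h, ih, pow_succ]

lemma commutator_inv_right_of_mem_center {x g : G} (h : ⁅x, g⁆ ∈ Subgroup.center G) :
    ⁅x, g⁻¹⁆ = ⁅x, g⁆⁻¹ := by
  have h1 := commutator_mul_right_of_mem_center (g := g⁻¹) h
  rw [inv_mul_cancel, commutatorElement_one_right] at h1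
  exact eq_inv_of_mul_eq_one_left h1.symm

lemma commutator_mul_center_left {x y g : G} (h : y ∈ Subgroup.center G) :
    ⁅x * y, g⁆ = ⁅x, g⁆ := by
  have h1 : ⁅y, g⁆ = 1 :=
    commutatorElement_eq_one_iff_mul_comm.mpr (Subgroup.mem_center_iff.mp h g).symm
  rw [commutator_mul_left_of_mem_center (by rw [h1]; exact one_mem _), h1, mul_one]

lemma mem_center_iff_commutator {x : G} : x ∈ Subgroup.center G ↔ ∀ g : G, ⁅x, g⁆ = 1 := by
  simp only [Subgroup.mem_center_iff, commutatorElement_eq_one_iff_mul_comm, eq_comm]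

lemma mul_pow_of_commutator_mem_center {x y : G} (h : ⁅y, x⁆ ∈ Subgroup.center G) (n : ℕ) :
    (x * y) ^ n = x ^ n * y ^ n * ⁅y, x⁆ ^ (n.choose 2) := by
  induction n with
  | zero => simp
  | succ n ih =>
    have hc := Subgroup.mem_center_iff.mp (pow_mem h (n.choose 2))
    have h2 : y ^ n * x = ⁅y, x⁆ ^ n * (x * y ^ n) := by
      rw [← commutator_pow_left_of_mem_center h, commutatorElement_def]; group
    have hc' := Subgroup.mem_center_iff.mp (pow_mem h n)
    have h3 : ⁅y, x⁆ ^ (n + 1).choose 2 = ⁅y, x⁆ ^ n * ⁅y, x⁆ ^ n.choose 2 := by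
      rw [← pow_add, Nat.choose_succ_succ' n 1, Nat.choose_one_right]
    rw [pow_succ, ih, h3, pow_succ, pow_succ]
    calc x ^ n * y ^ n * ⁅y, x⁆ ^ n.choose 2 * (x * y)
        = x ^ n * (y ^ n * x) * y * ⁅y, x⁆ ^ n.choose 2 := by
          rw [mul_assoc _ (_ ^ n.choose 2), ← hc]; simp only [mul_assoc]
      _ = x ^ n * x * (y ^ n * y) * (⁅y, x⁆ ^ n * ⁅y, x⁆ ^ n.choose 2) := by
          have hl : ∀ a b, ⁅y, x⁆ ^ n * (a * b) = a * (⁅y, x⁆ ^ n * b) := by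
            intro a b; rw [← mul_assoc, ← hc', mul_assoc]
          rw [h2]
          generalize ⁅y, x⁆ ^ n = c at hl
          simp only [mul_assoc, hl]

end CentralCommutators

/-! ### The centre, the abelian case and the second centre. -/

section Center

variable {p : ℕ} [hpf : Fact p.Prime] {G : Type*} [Group G] [Finite G]

/-- The witness is a central element whose order is the exponent of the centre. Centrality passes to
its powers, hence to all elements whose order divides `p ^ k`. -/
lemma IsPGroup.exists_mem_center_iff (hp : IsPGroup p G) (hreg : IsTupleRegular 2 G) :
    ∃ k, (∀ g, g ∈ Subgroup.center G ↔ g ^ p ^ k = 1) ∧ ∃ x : G, orderOf x = p ^ k := by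
  let _ : CommGroup (Subgroup.center G) := { (inferInstance : Group (Subgroup.center G)) with
    mul_comm := fun a b => Subtype.ext (Subgroup.mem_center_iff.mp b.2 a) }
  obtain ⟨x, hx⟩ := Monoid.exists_orderOf_eq_exponent (G := Subgroup.center G) .of_finite
  obtain ⟨k, hk⟩ := IsPGroup.iff_orderOf.mp hp (x : G)
  have hexp : Monoid.exponent (Subgroup.center G) = p ^ k := by
    rw [← hx, ← hk, Subgroup.orderOf_coe]
  refine ⟨k, fun g => ⟨fun hg => ?_, fun hg => ?_⟩, x, hk⟩
  · have := Monoid.pow_exponent_eq_one (⟨g, hg⟩ : Subgroup.center G)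
    rw [hexp] at this
    simpa using congrArg Subtype.val this
  -- With exponents `0` and `1` the condition on `x` is empty and the property is centrality.
  · have key := of_orderOf_dvd (G := G) (S := fun g => ∀ x : G, x ^ 0 = 1 → ⁅g, x⁆ ^ 1 = 1)
      (fun g h => hreg.commutator_pow_eq_one 0 1) (fun g n h x hx => ?_) (x := (x : G)) (g := g)
      (fun y _ => ?_) (hk ▸ orderOf_dvd_of_pow_eq_one hg)
    · simpa [mem_center_iff_commutator] using key
    · have h1 : g ∈ Subgroup.center G := mem_center_iff_commutator.mpr (by simpa using h)
      simpa using mem_center_iff_commutator.mp (pow_mem h1 n) x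
    · simpa using mem_center_iff_commutator.mp x.2 y

/-- Some element of order `p` is a `p ^ (k - 1)`-th power, so all are. Applied to an element of
order `p` inside one cyclic factor, this forces the factor to have full order `p ^ k`. -/
lemma isHomocyclic_of_commute (hreg : IsTupleRegular 2 G) (hcomm : ∀ a b : G, a * b = b * a)
    {k : ℕ} (hexp : ∀ g : G, g ^ p ^ k = 1) (hx : ∃ x : G, orderOf x = p ^ k) :
    IsHomocyclic p G := by
  have hpp := hpf.out
  let _ : CommGroup G := { (inferInstance : Group G) with mul_comm := hcomm }
  obtain ⟨ι, hι, n, hn, ⟨e⟩⟩ := CommGroup.equiv_prod_multiplicative_zmod_of_finite G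
  classical
  have key : ∀ i, n i = p ^ k := by
    intro i
    have h1 : n i ∣ p ^ k := by
      have h2 := hexp (e.symm (Pi.mulSingle i (Multiplicative.ofAdd 1)))
      rw [← map_pow, map_eq_one_iff _ e.symm.injective] at h2
      have h3 := congrFun h2 i
      rw [Pi.pow_apply, Pi.mulSingle_eq_same, Pi.one_apply, ← ofAdd_nsmul, ofAdd_eq_one,
        nsmul_one] at h3
      exact (ZMod.natCast_eq_zero_iff _ _).mp h3
    obtain ⟨f, hf, hnf⟩ := (Nat.dvd_prime_pow hpp).mp h1
    have hf0 : f ≠ 0 := by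
      rintro rfl
      have := hn i
      simp [hnf] at this
    have hk0 : k ≠ 0 := by omega
    set t : (i : ι) → Multiplicative (ZMod (n i)) :=
      Pi.mulSingle i (Multiplicative.ofAdd ((p ^ (f - 1) : ℕ) : ZMod (n i))) with ht
    have ht1 : orderOf t = p := by
      apply orderOf_eq_prime
      · rw [ht, ← Pi.mulSingle_pow, ← ofAdd_nsmul]
        have : p • ((p ^ (f - 1) : ℕ) : ZMod (n i)) = 0 := by
          rw [nsmul_eq_mul, ← Nat.cast_mul, ← pow_succ', Nat.sub_add_cancel (by omega), ← hnf]
          simp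
        rw [this, ofAdd_zero, Pi.mulSingle_one]
      · rw [ht, Ne, Pi.mulSingle_eq_one_iff, ofAdd_eq_one, ZMod.natCast_eq_zero_iff, hnf,
          Nat.pow_dvd_pow_iff_le_right hpp.one_lt]
        omega
    obtain ⟨x, hx⟩ := hx
    have hxo : orderOf (x ^ p ^ (k - 1)) = orderOf (e.symm t) := by
      rw [MulEquiv.orderOf_eq, ht1, orderOf_pow, hx,
        Nat.gcd_eq_right (pow_dvd_pow _ (Nat.sub_le _ _)), Nat.pow_div (Nat.sub_le _ _) hpp.pos]
      rw [Nat.sub_sub_self (by omega), pow_one]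
    obtain ⟨y, hy⟩ := hreg.exists_root (p ^ (k - 1)) hxo ⟨x, rfl⟩
    have h4 : (e y) ^ p ^ (k - 1) = t := by rw [← map_pow, hy, e.apply_symm_apply]
    have h5 := congrFun h4 i
    rw [ht, Pi.mulSingle_eq_same, Pi.pow_apply] at h5
    have hfk : ¬ f ≤ k - 1 := by
      intro hfk
      have h6 : (e y i) ^ p ^ (k - 1) = 1 := by
        rw [← ofAdd_toAdd (e y i), ← ofAdd_nsmul, nsmul_eq_mul,
          (ZMod.natCast_eq_zero_iff _ _).mpr (hnf ▸ pow_dvd_pow p hfk), zero_mul, ofAdd_zero]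
      rw [h6, eq_comm, ofAdd_eq_one, ZMod.natCast_eq_zero_iff, hnf,
          Nat.pow_dvd_pow_iff_le_right hpp.one_lt] at h5
      omega
    rw [hnf]
    congr 1
    omega
  obtain rfl : n = fun _ => p ^ k := funext key
  exact ⟨Fintype.card ι, k, ⟨e.trans
    ((MulEquiv.refl (Multiplicative (ZMod (p ^ k)))).arrowCongr (Fintype.equivFin ι))⟩⟩

/-- The properties of a nonabelian `2`-tuple regular `p`-group with centre of exponent `p ^ k` that
are used below: its elements of order at most `p ^ (k + 1)` lie in the second centre. -/
structure CentralLayer (p k : ℕ) (G : Type*) [Group G] : Prop where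
  reg : IsTupleRegular 2 G
  pos : 0 < k
  mem_center_iff : ∀ g : G, g ∈ Subgroup.center G ↔ g ^ p ^ k = 1
  exists_notMem : ∃ x : G, x ^ p ^ (k + 1) = 1 ∧ x ∉ Subgroup.center G
  commutator_mem : ∀ {x : G}, x ^ p ^ (k + 1) = 1 → ∀ g, ⁅x, g⁆ ∈ Subgroup.center G

/-- Some noncentral `x` becomes central modulo the centre. Its order is a multiple of `p ^ (k + 1)`,
and lying in the second centre is a property visible through one further element and inherited by
powers; so it reaches the whole layer. -/
lemma IsPGroup.centralLayer (hp : IsPGroup p G) (hreg : IsTupleRegular 2 G) {k : ℕ}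
    (hZ : ∀ g, g ∈ Subgroup.center G ↔ g ^ p ^ k = 1) (hG : Subgroup.center G ≠ ⊤) :
    CentralLayer p k G := by
  have hpp := hpf.out
  have hk : 0 < k := by
    by_contra h0
    obtain rfl : k = 0 := by omega
    have hnt : Nontrivial G := by
      by_contra hs
      rw [not_nontrivial_iff_subsingleton] at hs
      exact hG (Subsingleton.elim _ _)
    have := hp.bot_lt_center
    refine this.ne' (eq_bot_iff.mpr fun g hg => ?_)
    simpa using (hZ g).mp hg
  have hord : ∀ x : G, x ∉ Subgroup.center G → p ^ (k + 1) ∣ orderOf x := by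
    intro x hx
    obtain ⟨j, hj⟩ := IsPGroup.iff_orderOf.mp hp x
    rw [hj]
    refine pow_dvd_pow _ ?_
    by_contra hlt
    refine hx ((hZ x).mpr ?_)
    rw [← orderOf_dvd_iff_pow_eq_one, hj]
    exact pow_dvd_pow _ (by omega)
  have hmem : ∀ {x g : G}, x ^ p ^ (k + 1) = 1 → ⁅x, g⁆ ∈ Subgroup.center G := by
    have hQ : Nontrivial (G ⧸ Subgroup.center G) :=
      (QuotientGroup.nontrivial_iff).mpr hG
    obtain ⟨⟨q, hq⟩, hq1⟩ := @exists_ne _ (hp.to_quotient (Subgroup.center G)).center_nontrivial 1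
    obtain ⟨x, rfl⟩ := QuotientGroup.mk_surjective q
    have hx : x ∉ Subgroup.center G := by
      intro hx
      apply hq1
      ext
      exact (QuotientGroup.eq_one_iff x).mpr hx
    have hS : ∀ y : G, (y : G ⧸ Subgroup.center G) ∈ Subgroup.center (G ⧸ Subgroup.center G) ↔
        ∀ g : G, g ^ 0 = 1 → ⁅y, g⁆ ^ p ^ k = 1 := by
      intro y
      rw [mem_center_iff_commutator]
      constructor
      · intro h g _
        rw [← hZ, ← QuotientGroup.eq_one_iff]
        exact h g
      · intro h g
        obtain ⟨g, rfl⟩ := QuotientGroup.mk_surjective g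
        have := h g (by simp)
        rw [← hZ, ← QuotientGroup.eq_one_iff] at this
        exact this
    intro y g hy
    rw [hZ]
    refine of_orderOf_dvd (G := G) (S := fun y => ∀ g : G, g ^ 0 = 1 → ⁅y, g⁆ ^ p ^ k = 1)
      (fun g h => hreg.commutator_pow_eq_one 0 _) (fun g n h => ?_) (x := x) (g := y)
      ((hS x).mp hq) ((orderOf_dvd_of_pow_eq_one hy).trans (hord x hx)) g (by simp)
    rw [← hS] at h ⊢
    exact pow_mem h n
  refine ⟨hreg, hk, hZ, ?_, fun hx g => hmem hx⟩
  obtain ⟨x, -, hx⟩ := SetLike.exists_of_lt (lt_top_iff_ne_top.mpr hG)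
  obtain ⟨m, hm⟩ := hord x hx
  have hm0 : m ≠ 0 := by rintro rfl; exact (orderOf_pos x).ne' hm
  have ho : orderOf (x ^ m) = p ^ (k + 1) := by
    rw [orderOf_pow_of_dvd hm0 ⟨_, by rw [hm, mul_comm]⟩, hm, Nat.mul_div_cancel _ (by omega)]
  refine ⟨x ^ m, ?_, fun h => ?_⟩
  · rw [← ho, pow_orderOf_eq_one]
  · rw [hZ, ← orderOf_dvd_iff_pow_eq_one, ho, Nat.pow_dvd_pow_iff_le_right hpp.one_lt] at h
    omega

end Center

/-! ### Commutation as a homomorphism, and counting by fibres. -/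

section Auxiliary

variable {G : Type*} [Group G]

lemma mem_zpowers_of_prime_pow_eq_one {p : ℕ} (hp : p.Prime) {b c : G} (hb : b ^ p = 1)
    (hc : c ∈ Subgroup.zpowers b) (hc1 : c ≠ 1) : b ∈ Subgroup.zpowers c := by
  obtain ⟨i, rfl⟩ := hc
  simp only at hc1 ⊢
  have hord : orderOf b = p :=
    have := Fact.mk hp
    orderOf_eq_prime hb (by rintro rfl; simp at hc1)
  rw [mem_zpowers_zpow_iff, hord, Int.gcd_comm, ← Int.isCoprime_iff_gcd_eq_one]
  refine (Nat.prime_iff_prime_int.mp hp).coprime_iff_not_dvd.mpr fun hd => hc1 ?_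
  rwa [← hord, orderOf_dvd_iff_zpow_eq_one] at hd

/-- The homomorphism `g ↦ ⁅x, g⁆` for an element `x` of the second centre. -/
def commutatorHom (x : G) (hx : ∀ g, ⁅x, g⁆ ∈ Subgroup.center G) : G →* G where
  toFun g := ⁅x, g⁆
  map_one' := commutatorElement_one_right x
  map_mul' _ h := commutator_mul_right_of_mem_center (hx h)

@[simp] lemma commutatorHom_apply (x : G) (hx : ∀ g, ⁅x, g⁆ ∈ Subgroup.center G) (g : G) :
    commutatorHom x hx g = ⁅x, g⁆ := rfl

lemma ker_commutatorHom (x : G) (hx : ∀ g, ⁅x, g⁆ ∈ Subgroup.center G) :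
    (commutatorHom x hx).ker = Subgroup.centralizer {x} := by
  ext g
  rw [MonoidHom.mem_ker, commutatorHom_apply, commutatorElement_eq_one_iff_mul_comm,
    Subgroup.mem_centralizer_singleton_iff, eq_comm]

/-- The central elements with trivial `p`-th power. -/
def centerTorsion (p : ℕ) (G : Type*) [Group G] : Subgroup G where
  carrier := {w | w ∈ Subgroup.center G ∧ w ^ p = 1}
  one_mem' := ⟨one_mem _, one_pow _⟩
  mul_mem' := by
    rintro a b ⟨ha, ha'⟩ ⟨hb, hb'⟩
    refine ⟨mul_mem ha hb, ?_⟩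
    rw [Commute.mul_pow (Subgroup.mem_center_iff.mp hb a), ha', hb', one_mul]
  inv_mem' := by
    rintro a ⟨ha, ha'⟩
    exact ⟨inv_mem ha, by rw [inv_pow, ha', inv_one]⟩

lemma mem_centerTorsion {p : ℕ} {w : G} :
    w ∈ centerTorsion p G ↔ w ∈ Subgroup.center G ∧ w ^ p = 1 := Iff.rfl

lemma card_eq_of_card_fiber [Finite G] (f : G → G) (W : Subgroup G) (hf : ∀ g, f g ∈ W) {R : ℕ}
    (hR : ∀ w ∈ W, w ≠ 1 → Nat.card {g // f g = w} = R) :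
    Nat.card G = Nat.card {g // f g = 1} + (Nat.card W - 1) * R := by
  classical
  have := Fintype.ofFinite G
  have h1 : Nat.card G = ∑ w : W, Nat.card {g // f g = w} := by
    rw [← Nat.card_sigma]
    refine Nat.card_congr ((Equiv.sigmaFiberEquiv (fun g => (⟨f g, hf g⟩ : W))).symm.trans ?_)
    exact Equiv.sigmaCongrRight fun w => Equiv.subtypeEquivRight fun g => Subtype.ext_iff
  rw [h1, ← Finset.add_sum_erase _ _ (Finset.mem_univ (1 : W))]
  congr 1
  rw [Finset.sum_congr rfl (g := fun _ => R), Finset.sum_const, smul_eq_mul,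
    Finset.card_erase_of_mem (Finset.mem_univ _), Finset.card_univ, Nat.card_eq_fintype_card]
  intro w hw
  refine hR w w.2 fun h => Finset.ne_of_mem_erase hw (Subtype.ext h)

end Auxiliary

/-! ### The layer of solutions of `x ^ p ^ (k + 1) = 1`. -/

namespace CentralLayer

variable {p k : ℕ} {G : Type*} [Group G]

lemma mem_center_of_pow_eq_one (h : CentralLayer p k G) {w : G} (hw : w ^ p = 1) :
    w ∈ Subgroup.center G := by
  rw [h.mem_center_iff, ← Nat.sub_add_cancel h.pos, pow_succ', pow_mul, hw, one_pow]

lemma mem_centerTorsion (h : CentralLayer p k G) {w : G} : w ∈ centerTorsion p G ↔ w ^ p = 1 :=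
  ⟨And.right, fun hw => ⟨h.mem_center_of_pow_eq_one hw, hw⟩⟩

lemma pow_mem_center (h : CentralLayer p k G) {x : G} (hx : x ^ p ^ (k + 1) = 1) :
    x ^ p ∈ Subgroup.center G := by
  rwa [h.mem_center_iff, ← pow_mul, ← pow_succ']

lemma pow_pow_eq_one {x : G} (hx : x ^ p ^ (k + 1) = 1) : (x ^ p ^ k) ^ p = 1 := by
  rwa [← pow_mul, ← pow_succ]

lemma commutator_pow_eq_one (h : CentralLayer p k G) {x : G} (hx : x ^ p ^ (k + 1) = 1) (g : G) :
    ⁅x, g⁆ ^ p = 1 := by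
  rw [← commutator_pow_left_of_mem_center (h.commutator_mem hx g)]
  exact mem_center_iff_commutator.mp (h.pow_mem_center hx) g

lemma pow_ne_one (h : CentralLayer p k G) {x : G} (hx : x ∉ Subgroup.center G) :
    x ^ p ^ k ≠ 1 := fun h1 => hx ((h.mem_center_iff x).mpr h1)

/-- If the `p ^ k`-th power map is multiplicative on the solutions of `x ^ p ^ (k + 1) = 1`, these
form a subgroup. -/
lemma exists_layer (h : CentralLayer p k G)
    (hmul : ∀ x y : G, x ^ p ^ (k + 1) = 1 → y ^ p ^ (k + 1) = 1 →
      (x * y) ^ p ^ k = x ^ p ^ k * y ^ p ^ k) :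
    ∃ L : Subgroup G, ∀ g, g ∈ L ↔ g ^ p ^ (k + 1) = 1 := by
  refine ⟨{ carrier := {x | x ^ p ^ (k + 1) = 1}, one_mem' := one_pow _, mul_mem' := ?_,
            inv_mem' := fun {x} hx => by simpa using hx }, fun g => Iff.rfl⟩
  intro x y hx hy
  rw [Set.mem_ofPred_eq] at *
  rw [pow_succ, pow_mul, hmul x y hx hy, Commute.mul_pow, pow_pow_eq_one hx, pow_pow_eq_one hy,
    one_mul]
  exact Subgroup.mem_center_iff.mp (h.mem_center_of_pow_eq_one (pow_pow_eq_one hy)) _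

/-- By multiplicativity some `y * x ^ (-i)` is killed by the `p ^ k`-th power, hence central: `y` is
a power of `x` up to the centre. -/
lemma commute_of_pow_mem_zpowers (h : CentralLayer p k G)
    (hmul : ∀ x y : G, x ^ p ^ (k + 1) = 1 → y ^ p ^ (k + 1) = 1 →
      (x * y) ^ p ^ k = x ^ p ^ k * y ^ p ^ k) {x y g : G} (hx : x ^ p ^ (k + 1) = 1)
    (hy : y ^ p ^ (k + 1) = 1) (hyx : y ^ p ^ k ∈ Subgroup.zpowers (x ^ p ^ k))
    (hg : Commute x g) : Commute y g := by
  obtain ⟨i, hi⟩ := hyx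
  simp only at hi
  have h1 : (y * x ^ (-i)) ^ p ^ k = 1 := by
    rw [hmul _ _ hy (by rw [← zpow_natCast, zpow_comm, zpow_natCast, hx, one_zpow]), ← hi,
      ← zpow_natCast, ← zpow_natCast, zpow_comm, zpow_neg, inv_zpow, mul_inv_cancel]
  rw [← h.mem_center_iff] at h1
  have h2 : y = (y * x ^ (-i)) * x ^ i := by rw [zpow_neg, inv_mul_cancel_right]
  rw [h2]
  exact Commute.mul_left (Subgroup.mem_center_iff.mp h1 g).symm (hg.zpow_left i)

variable [hpf : Fact p.Prime]

lemma orderOf_eq (h : CentralLayer p k G) {x : G} (hx : x ^ p ^ (k + 1) = 1)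
    (hxZ : x ∉ Subgroup.center G) : orderOf x = p ^ (k + 1) :=
  orderOf_eq_prime_pow (h.pow_ne_one hxZ) hx

lemma mem_zpowers_pow (h : CentralLayer p k G) {x z : G} (hx : x ^ p ^ (k + 1) = 1)
    (hxZ : x ∉ Subgroup.center G) (hz : z ^ p = 1) (hzx : z ∈ Subgroup.zpowers x) :
    z ∈ Subgroup.zpowers (x ^ p ^ k) := by
  obtain ⟨i, rfl⟩ := hzx
  have h1 : x ^ (i * p) = 1 := by rw [zpow_mul, zpow_natCast]; exact hz
  rw [← orderOf_dvd_iff_zpow_eq_one, h.orderOf_eq hx hxZ, pow_succ, Nat.cast_mul] at h1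
  obtain ⟨j, rfl⟩ := Int.dvd_of_mul_dvd_mul_right (by exact_mod_cast hpf.out.ne_zero) h1
  refine ⟨j, ?_⟩
  simp only [zpow_mul, zpow_natCast]

/-- The commutators of a noncentral element `x` of the second layer with a subgroup defined by
the order of its elements exhaust the elements of order `p`, unless they are powers of `x`. -/
lemma exists_commutator_eq (h : CentralLayer p k G) (K : Subgroup G) (N : ℕ)
    (hK : ∀ g, g ∈ K ↔ g ^ N = 1) {x g w : G} (hx : x ^ p ^ (k + 1) = 1)
    (hxZ : x ∉ Subgroup.center G) (hg : g ∈ K) (hgx : ⁅x, g⁆ ∉ Subgroup.zpowers (x ^ p ^ k))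
    (hw : w ^ p = 1) : ∃ g ∈ K, ⁅x, g⁆ = w := by
  have key : ∀ w : G, w ^ p = 1 → w ∉ Subgroup.zpowers (x ^ p ^ k) → ∃ g ∈ K, ⁅x, g⁆ = w := by
    intro w hw hwx
    have hc : ∀ z : G, z ^ p = 1 → Commute x z := fun z hz =>
      Subgroup.mem_center_iff.mp (h.mem_center_of_pow_eq_one hz) x
    have hz := h.commutator_pow_eq_one hx g
    obtain ⟨g', h1, h2⟩ := h.reg.exists_commutator_eq hpf.out N (hc _ hz) (hc w hw)
      hz hw (fun hm => hgx (h.mem_zpowers_pow hx hxZ hz hm))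
      (fun hm => hwx (h.mem_zpowers_pow hx hxZ hw hm)) ⟨g, (hK g).mp hg, rfl⟩
    exact ⟨g', (hK g').mpr h1, h2⟩
  by_cases hwx : w ∈ Subgroup.zpowers (x ^ p ^ k)
  · have hz := h.commutator_pow_eq_one hx g
    have hzc := h.commutator_mem hx g
    -- A `w` inside `⟨x ^ p ^ k⟩` is shifted outside by the commutator already known to lie outside;
    -- the factor is removed again by `g⁻¹`.
    obtain ⟨g', h1, h2⟩ := key (w * ⁅x, g⁆)
      (by rw [Commute.mul_pow (Subgroup.mem_center_iff.mp hzc w), hw, hz, one_mul])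
      (fun hm => hgx ((Subgroup.mul_mem_cancel_left _ hwx).mp hm))
    refine ⟨g' * g⁻¹, mul_mem h1 (inv_mem hg), ?_⟩
    rw [commutator_mul_right_of_mem_center (h.commutator_mem hx _),
      commutator_inv_right_of_mem_center hzc, h2, mul_inv_cancel_right]
  · exact key w hw hwx

/-- Under the multiplicativity hypothesis the layer is abelian. -/
lemma commute_of_pow_mul [Finite G] (h : CentralLayer p k G)
    (hmul : ∀ x y : G, x ^ p ^ (k + 1) = 1 → y ^ p ^ (k + 1) = 1 →
      (x * y) ^ p ^ k = x ^ p ^ k * y ^ p ^ k) {x y : G} (hx : x ^ p ^ (k + 1) = 1)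
    (hy : y ^ p ^ (k + 1) = 1) : Commute x y := by
  obtain ⟨L, hL⟩ := h.exists_layer hmul
  -- Otherwise commutation with `x` on `L` would reach every element with trivial `p`-th power, in
  -- particular the image of the power map `q`. Its kernel contains that of `q`, which is the
  -- centre, so both kernels would be equal by orders; but `x` commutes with itself and is not
  -- central.
  have hsub : ∀ x y : G, x ^ p ^ (k + 1) = 1 → y ^ p ^ (k + 1) = 1 →
      ⁅x, y⁆ ∈ Subgroup.zpowers (x ^ p ^ k) := by
    intro x y hx hy
    by_contra hxy
    have hxZ : x ∉ Subgroup.center G := fun hxZ => hxy (by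
      rw [mem_center_iff_commutator.mp hxZ]; exact one_mem _)
    let f : L →* G := (commutatorHom x (h.commutator_mem hx)).comp L.subtype
    let q : L →* G :=
      { toFun := fun g => (g : G) ^ p ^ k
        map_one' := one_pow _
        map_mul' := fun a b => hmul a b ((hL _).mp a.2) ((hL _).mp b.2) }
    have hrange : q.range ≤ f.range := by
      rintro _ ⟨a, rfl⟩
      obtain ⟨g, hg, hg'⟩ := h.exists_commutator_eq L _ hL hx hxZ ((hL y).mpr hy) hxy
        (pow_pow_eq_one ((hL _).mp a.2))
      exact ⟨⟨g, hg⟩, hg'⟩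
    have hker : q.ker ≤ f.ker := by
      intro a ha
      have ha' : (a : G) ∈ Subgroup.center G := (h.mem_center_iff _).mpr ha
      exact commutatorElement_eq_one_iff_mul_comm.mpr (Subgroup.mem_center_iff.mp ha' x)
    have h1 := q.ker.card_mul_index
    have h2 := f.ker.card_mul_index
    rw [Subgroup.index_ker] at h1 h2
    have h3 : Nat.card q.range ≤ Nat.card f.range := Subgroup.card_le_of_le hrange
    have h4 : Nat.card f.ker ≤ Nat.card q.ker := by
      by_contra hlt
      have h5 : Nat.card q.ker * Nat.card q.range < Nat.card f.ker * Nat.card f.range :=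
        Nat.mul_lt_mul_of_lt_of_le (not_le.mp hlt) h3 Nat.card_pos
      omega
    have h5 := Subgroup.eq_of_le_of_card_ge hker h4
    have h6 : (⟨x, (hL x).mpr hx⟩ : L) ∈ f.ker := commutatorElement_self x
    rw [← h5] at h6
    exact hxZ ((h.mem_center_iff x).mpr h6)
  by_contra hxy
  have hne : ⁅x, y⁆ ≠ 1 := fun h1 => hxy (commutatorElement_eq_one_iff_commute.mp h1)
  have h1 := hsub x y hx hy
  have h2 := hsub y x hy hx
  rw [← commutatorElement_inv, inv_mem_iff] at h2
  -- The nontrivial commutator lies in both groups of order `p`, so `⟨x ^ p ^ k⟩` and `⟨y ^ p ^ k⟩`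
  -- coincide.
  have h3 := mem_zpowers_of_prime_pow_eq_one hpf.out (pow_pow_eq_one hy) h2 hne
  have h4 := Subgroup.zpowers_le.mpr h1 h3
  exact hxy (h.commute_of_pow_mem_zpowers hmul hx hy h4 (Commute.refl x)).symm

/-- The layer is not abelian. -/
lemma not_commute [Finite G] (h : CentralLayer p k G) (hp : IsPGroup p G)
    (hcomm : ∀ x y : G, x ^ p ^ (k + 1) = 1 → y ^ p ^ (k + 1) = 1 → Commute x y) : False := by
  have hpp := hpf.out
  have hmul : ∀ x y : G, x ^ p ^ (k + 1) = 1 → y ^ p ^ (k + 1) = 1 →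
      (x * y) ^ p ^ k = x ^ p ^ k * y ^ p ^ k := fun x y hx hy => (hcomm x y hx hy).mul_pow _
  obtain ⟨L, hL⟩ := h.exists_layer hmul
  have hC : ∀ g, g ∈ Subgroup.centralizer (L : Set G) ↔
      ∀ x : G, x ^ p ^ (k + 1) = 1 → ⁅g, x⁆ ^ 1 = 1 := by
    intro g
    simp only [Subgroup.mem_centralizer_iff, SetLike.mem_coe, hL, pow_one,
      commutatorElement_eq_one_iff_mul_comm]
    exact forall₂_congr fun x _ => eq_comm
  set C := Subgroup.centralizer (L : Set G) with hCdef
  have htype : ∀ {x g : G}, x ∈ C → orderOf g ∣ orderOf x → g ∈ C := by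
    intro x g hx hgx
    rw [hC] at hx ⊢
    refine of_orderOf_dvd (S := fun g : G => ∀ x : G, x ^ p ^ (k + 1) = 1 → ⁅g, x⁆ ^ 1 = 1)
      (fun g h' => h.reg.commutator_pow_eq_one _ _) (fun g n h' => ?_) hx hgx
    rw [← hC] at h' ⊢
    exact pow_mem h' n
  have hpow : ∀ g, g ^ p ∈ C := by
    intro g
    rw [hC]
    intro x hx
    have hc := h.commutator_mem hx g
    rw [pow_one, ← commutatorElement_inv, commutator_pow_right_of_mem_center hc,
      h.commutator_pow_eq_one hx, inv_one]
  obtain ⟨x₁, hx₁, hx₁Z⟩ := h.exists_notMem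
  obtain ⟨g₀, hg₀⟩ : ∃ g₀, g₀ ∉ C := by
    by_contra! hall
    refine hx₁Z (Subgroup.mem_center_iff.mpr fun g => ?_)
    exact ((Subgroup.mem_centralizer_iff.mp (hall g)) x₁ ((hL x₁).mpr hx₁)).symm
  obtain ⟨m, hm⟩ := IsPGroup.iff_orderOf.mp hp g₀
  obtain ⟨M, rfl⟩ : ∃ M, m = M + 1 := by
    refine Nat.exists_eq_succ_of_ne_zero ?_
    rintro rfl
    rw [pow_zero, orderOf_eq_one_iff] at hm
    exact hg₀ (hm ▸ one_mem _)
  -- Membership in `C` is governed by the order. As `g₀` of order `p ^ (M + 1)` is outside `C` while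
  -- its `p`-th power is inside, the cut lies exactly at `p ^ M`.
  have hCM : ∀ g, g ∈ C ↔ g ^ p ^ M = 1 := by
    intro g
    constructor
    · intro hg
      by_contra hne
      refine hg₀ (htype hg ?_)
      obtain ⟨j, hj⟩ := IsPGroup.iff_orderOf.mp hp g
      rw [hm, hj]
      refine pow_dvd_pow _ ?_
      by_contra hlt
      exact hne (orderOf_dvd_iff_pow_eq_one.mp (hj ▸ pow_dvd_pow _ (by omega)))
    · intro hg
      refine htype (hpow g₀) ?_
      rw [orderOf_pow_of_dvd hpp.ne_zero (hm ▸ dvd_pow_self p (by omega)), hm, pow_succ,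
        Nat.mul_div_cancel _ hpp.pos]
      exact orderOf_dvd_of_pow_eq_one hg
  have hexp : ∀ g : G, (g ^ p ^ M) ^ p = 1 := by
    intro g
    rw [← pow_mul, mul_comm, pow_mul]
    exact (hCM _).mp (hpow g)
  have hLC : ∀ x : G, x ^ p ^ (k + 1) = 1 → x ∈ C := by
    intro x hx
    rw [hC]
    intro y hy
    rw [pow_one, (hcomm x y hx hy).commutator_eq]
  have hkM : k < M := by
    have h1 := (hCM x₁).mp (hLC x₁ hx₁)
    rw [← orderOf_dvd_iff_pow_eq_one, h.orderOf_eq hx₁ hx₁Z,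
      Nat.pow_dvd_pow_iff_le_right hpp.one_lt] at h1
    omega
  obtain ⟨d, rfl⟩ : ∃ d, M = d + k := ⟨M - k, by omega⟩
  -- the power of `g ∉ C` in the layer
  have hroot : ∀ g : G, (g ^ p ^ d) ^ p ^ k = g ^ p ^ (d + k) := by
    intro g; rw [← pow_mul, ← pow_add]
  have hrootL : ∀ g : G, (g ^ p ^ d) ^ p ^ (k + 1) = 1 := by
    intro g; rw [pow_succ, pow_mul, hroot, hexp]
  -- In the first case `x` and `x₀ * x`, with `x₀` a power of `g₀`, have the same nontrivial
  -- commutator with `g₀`. This puts `x₀ ^ p ^ k` into `⟨x ^ p ^ k⟩`, so `x` is a power of `x₀` up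
  -- to the centre and commutes with `g₀`. The second case is a count.
  by_cases hcase : ∀ x g : G, x ^ p ^ (k + 1) = 1 → ⁅x, g⁆ ∈ Subgroup.zpowers (x ^ p ^ k)
  · obtain ⟨x, hx, hxg⟩ : ∃ x : G, x ^ p ^ (k + 1) = 1 ∧ ⁅x, g₀⁆ ≠ 1 := by
      by_contra! hall
      refine hg₀ ((hC g₀).mpr fun x hx => ?_)
      rw [pow_one, ← commutatorElement_inv, hall x hx, inv_one]
    have hx0 := hrootL g₀
    set x₀ := g₀ ^ p ^ d with hx₀
    have hx0g : Commute x₀ g₀ := Commute.pow_left (Commute.refl _) _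
    have hxx : (x₀ * x) ^ p ^ (k + 1) = 1 := by
      rw [(hcomm _ _ hx0 hx).mul_pow, hx0, hx, one_mul]
    have e1 : ⁅x₀ * x, g₀⁆ = ⁅x, g₀⁆ := by
      rw [commutator_mul_left_of_mem_center (h.commutator_mem hx _), hx0g.commutator_eq, one_mul]
    have h1 := hcase x g₀ hx
    have h2 := hcase _ g₀ hxx
    rw [e1] at h2
    have h3 := mem_zpowers_of_prime_pow_eq_one hpp (pow_pow_eq_one hxx) h2 hxg
    have h4 := Subgroup.zpowers_le.mpr h1 h3
    rw [hmul _ _ hx0 hx,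
      Subgroup.mul_mem_cancel_right _ (Subgroup.mem_zpowers _)] at h4
    have h5 : x₀ ^ p ^ k ≠ 1 := by
      rw [hroot]; exact fun h5 => hg₀ ((hCM _).mpr h5)
    have h6 := mem_zpowers_of_prime_pow_eq_one hpp (pow_pow_eq_one hx) h4 h5
    exact hxg (h.commute_of_pow_mem_zpowers hmul hx0 hx h6 hx0g).commutator_eq
  · push Not at hcase
    obtain ⟨x, g, hx, hxg⟩ := hcase
    have hxZ : x ∉ Subgroup.center G := fun hxZ => hxg (by
      rw [mem_center_iff_commutator.mp hxZ]; exact one_mem _)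
    have hrange : (commutatorHom x (h.commutator_mem hx)).range = centerTorsion p G := by
      ext w
      rw [h.mem_centerTorsion]
      constructor
      · rintro ⟨g', rfl⟩
        exact h.commutator_pow_eq_one hx g'
      · intro hw
        obtain ⟨g', -, hg'⟩ := h.exists_commutator_eq ⊤ 0 (by simp) hx hxZ
          (Subgroup.mem_top g) hxg hw
        exact ⟨g', hg'⟩
    have h1 := (commutatorHom x (h.commutator_mem hx)).ker.card_mul_index
    rw [Subgroup.index_ker, hrange, ker_commutatorHom] at h1
    have hxo : orderOf (x ^ p ^ k) = p := orderOf_eq_prime (pow_pow_eq_one hx) (h.pow_ne_one hxZ)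
    have h2 := card_eq_of_card_fiber (fun g : G => g ^ p ^ (d + k)) (centerTorsion p G)
      (fun g => h.mem_centerTorsion.mpr (hexp g))
      (R := Nat.card {g : G // g ^ p ^ (d + k) = x ^ p ^ k}) fun w hw hw1 => by
        refine h.reg.card_roots _ ?_
        rw [hxo, orderOf_eq_prime (h.mem_centerTorsion.mp hw) hw1]
    have h3 : Nat.card {g : G // g ^ p ^ (d + k) = 1} = Nat.card C :=
      Nat.card_congr (Equiv.subtypeEquivRight fun g => (hCM g).symm)
    rw [h3] at h2
    set R := Nat.card {g : G // g ^ p ^ (d + k) = x ^ p ^ k}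
    -- The `p ^ (d + k)`-th roots of `x ^ p ^ k` commute with `x`, since their powers in the layer
    -- agree with a power of `x` up to the centre. They are disjoint from `C`, whose elements are
    -- the roots of `1`.
    have h4 : R + Nat.card C ≤ Nat.card (Subgroup.centralizer {x}) := by
      have e : Nat.card ({g : G // g ^ p ^ (d + k) = x ^ p ^ k} ⊕ C) = R + Nat.card C := by
        rw [Nat.card_sum]
      rw [← e]
      have hm1 : ∀ g : G, g ^ p ^ (d + k) = x ^ p ^ k → g ∈ Subgroup.centralizer {x} := by
        intro g hg
        rw [Subgroup.mem_centralizer_singleton_iff]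
        refine (h.commute_of_pow_mem_zpowers hmul (hrootL g) hx ?_
          (Commute.pow_left (Commute.refl g) _)).symm
        rw [hroot, hg]
        exact Subgroup.mem_zpowers _
      have hm2 : ∀ g : G, g ∈ C → g ∈ Subgroup.centralizer {x} := by
        intro g hg
        rw [Subgroup.mem_centralizer_singleton_iff]
        exact (Subgroup.mem_centralizer_iff.mp hg x ((hL x).mpr hx)).symm
      refine Nat.card_le_card_of_injective (Sum.elim (fun g => ⟨g.1, hm1 g.1 g.2⟩)
        (fun g => ⟨g.1, hm2 g.1 g.2⟩)) ?_
      refine Function.Injective.sumElim ?_ ?_ ?_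
      · intro a b hab
        exact Subtype.ext (congrArg (Subtype.val : Subgroup.centralizer {x} → G) hab)
      · intro a b hab
        exact Subtype.ext (congrArg (Subtype.val : Subgroup.centralizer {x} → G) hab)
      · intro a b hab
        have hab' : (a : G) = b := congrArg (Subtype.val : Subgroup.centralizer {x} → G) hab
        have := (hCM b).mp b.2
        rw [← hab', a.2] at this
        exact h.pow_ne_one hxZ this
    have h5 : 2 ≤ Nat.card (centerTorsion p G) := by
      have : Nontrivial (centerTorsion p G) := by
        refine ⟨⟨x ^ p ^ k, h.mem_centerTorsion.mpr (pow_pow_eq_one hx)⟩, 1, fun he => ?_⟩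
        exact h.pow_ne_one hxZ (congrArg Subtype.val he)
      exact Finite.one_lt_card
    have h6 : 0 < Nat.card C := Nat.card_pos
    generalize Nat.card C = c at *
    generalize Nat.card (Subgroup.centralizer {x}) = e at *
    generalize Nat.card G = n at *
    obtain ⟨w, hw⟩ : ∃ w, Nat.card (centerTorsion p G) = w + 2 := ⟨_, (Nat.sub_add_cancel h5).symm⟩
    rw [hw] at h1 h2
    have e2 : w + 2 - 1 = w + 1 := rfl
    rw [e2] at h2
    -- With `t = w + 2` central elements of trivial `p`-th power, `n = e * t ≥ (R + c) * t`, which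
    -- exceeds `c + (t - 1) * R = n`.
    nlinarith [Nat.mul_le_mul_left (w + 1) h4]

end CentralLayer

/-- The correction term in `(x * y) ^ p ^ k` is a commutator raised to `(p ^ k).choose 2`. It
vanishes when `p` divides this number, which fails only for `p ^ k = 2`. -/
lemma CentralLayer.eq_two_and_eq_one {p k : ℕ} [hpf : Fact p.Prime] {G : Type*} [Group G]
    [Finite G] (h : CentralLayer p k G) (hp : IsPGroup p G) : p = 2 ∧ k = 1 := by
  by_contra hpk
  have hne : 2 ≠ p ^ k := by
    intro he
    have h1 : p ∣ 2 := he ▸ dvd_pow_self p h.pos.ne'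
    have h2 := (Nat.prime_dvd_prime_iff_eq hpf.out Nat.prime_two).mp h1
    subst h2
    exact hpk ⟨rfl, (Nat.pow_right_injective le_rfl (by simpa using he)).symm⟩
  refine h.not_commute hp fun x y hx hy => h.commute_of_pow_mul (fun x y hx hy => ?_) hx hy
  obtain ⟨d, hd⟩ := hpf.out.dvd_choose_pow two_ne_zero hne
  rw [mul_pow_of_commutator_mem_center (h.commutator_mem hy x), hd, pow_mul,
    h.commutator_pow_eq_one hy, one_pow, mul_one]

/-- A noncentral element of the layer cannot centralize the layer, as otherwise the layer would be
abelian. But the square of an element of order eight is noncentral in the layer, and squares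
centralize the layer. -/
lemma CentralLayer.pow_four_eq_one {G : Type*} [Group G] [Finite G] (h : CentralLayer 2 1 G)
    (hp : IsPGroup 2 G) (g : G) : g ^ 4 = 1 := by
  have hcent : ∀ x : G, x ^ 4 = 1 → x ∉ Subgroup.center G → ∃ y : G, y ^ 4 = 1 ∧ ⁅x, y⁆ ≠ 1 := by
    intro x hx hxZ
    by_contra! hall
    refine h.not_commute hp fun y z hy hz => ?_
    have hxo := h.orderOf_eq hx hxZ
    rw [← commutatorElement_eq_one_iff_commute, ← pow_one ⁅y, z⁆]
    refine of_orderOf_dvd (S := fun y : G => ∀ z : G, z ^ 4 = 1 → ⁅y, z⁆ ^ 1 = 1)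
      (fun g h' => h.reg.commutator_pow_eq_one _ _) (fun u n hu v hv => ?_)
      (x := x) (fun z hz => by rw [pow_one, hall z hz])
      (hxo ▸ orderOf_dvd_of_pow_eq_one hy) z hz
    have hc : Commute u v := commutatorElement_eq_one_iff_commute.mp (by simpa using hu v hv)
    rw [pow_one, (hc.pow_left n).commutator_eq]
  by_contra hg
  obtain ⟨j, hj⟩ := IsPGroup.iff_orderOf.mp hp g
  obtain ⟨i, rfl⟩ : ∃ i, j = i + 3 := by
    refine Nat.exists_eq_add_of_le' ?_
    by_contra hlt
    refine hg (orderOf_dvd_iff_pow_eq_one.mp ?_)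
    rw [hj]
    exact pow_dvd_pow 2 (show j ≤ 2 by omega)
  have h1 : ((g ^ 2 ^ i) ^ 2) ^ 4 = 1 := by
    rw [← pow_mul, ← pow_mul, ← orderOf_dvd_iff_pow_eq_one, hj, pow_add]
    norm_num
  have h2 : (g ^ 2 ^ i) ^ 2 ∉ Subgroup.center G := by
    rw [h.mem_center_iff, pow_one, ← pow_mul, ← pow_mul, ← orderOf_dvd_iff_pow_eq_one, hj,
      show 2 * 2 = 2 ^ 2 by norm_num, ← pow_add, Nat.pow_dvd_pow_iff_le_right (by norm_num)]
    omega
  obtain ⟨y, hy, hne⟩ := hcent _ h1 h2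
  apply hne
  rw [← commutatorElement_inv, commutator_pow_right_of_mem_center (h.commutator_mem hy _),
    h.commutator_pow_eq_one hy, inv_one]

/-! ### Exponent four: commutators and the orders of centralizers. -/

/-- The properties of a `2`-tuple regular `2`-group of exponent four whose centre consists of the
elements of order at most two and in which every noncentral element has all central elements as
commutators. -/
structure SquareCentral (G : Type*) [Group G] : Prop where
  reg : IsTupleRegular 2 G
  mem_center_iff : ∀ g : G, g ∈ Subgroup.center G ↔ g ^ 2 = 1
  commutator_mem : ∀ x g : G, ⁅x, g⁆ ∈ Subgroup.center G
  sq_mem : ∀ x : G, x ^ 2 ∈ Subgroup.center G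
  exists_notMem : ∃ x : G, x ∉ Subgroup.center G
  exists_commutator : ∀ x w : G, x ∉ Subgroup.center G → w ∈ Subgroup.center G → ∃ g, ⁅x, g⁆ = w

/-- The point is surjectivity of commutation onto the centre. If it fails for one `x`, the only
nontrivial commutator with `x` is `x ^ 2`. By regularity this holds for all noncentral elements, and
it makes all their squares equal; every central involution, being a square, is then that commutator
after all. -/
lemma CentralLayer.squareCentral {G : Type*} [Group G] [Finite G] (h : CentralLayer 2 1 G)
    (hp : IsPGroup 2 G) : SquareCentral G := by
  have h4 := h.pow_four_eq_one hp
  have hZ : ∀ g : G, g ∈ Subgroup.center G ↔ g ^ 2 = 1 := h.mem_center_iff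
  have hcm : ∀ x g : G, ⁅x, g⁆ ∈ Subgroup.center G := fun x g => h.commutator_mem (h4 x) g
  have hsq : ∀ x : G, x ^ 2 ∈ Subgroup.center G := fun x => h.pow_mem_center (h4 x)
  have hnm : ∃ x : G, x ∉ Subgroup.center G := by
    obtain ⟨x, -, hx⟩ := h.exists_notMem
    exact ⟨x, hx⟩
  refine ⟨h.reg, hZ, hcm, hsq, hnm, fun x w hx hw => ?_⟩
  by_contra hcon
  have hself : ∀ x g : G, ⁅x, g⁆ = ⁅g, x⁆ := by
    intro x g
    rw [← commutatorElement_inv x g]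
    exact eq_inv_of_mul_eq_one_left (by rw [← sq, (hZ _).mp (hcm x g)])
  have hP : ∀ g, ⁅x, g⁆ ≠ 1 → ⁅x, g⁆ = x ^ 2 := by
    intro g hg
    by_contra hne
    have hnm : ⁅x, g⁆ ∉ Subgroup.zpowers (x ^ 2 ^ 1) := by
      rw [pow_one]
      rintro ⟨i, hi⟩
      simp only at hi
      have hx2 : (x ^ 2) ^ (2 : ℤ) = 1 := by
        norm_cast
        rw [← pow_mul]
        exact h4 x
      obtain ⟨j, rfl | rfl⟩ := Int.even_or_odd' i
      · rw [zpow_mul, hx2, one_zpow] at hi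
        exact hg hi.symm
      · rw [zpow_add, zpow_mul, zpow_one, hx2, one_zpow, one_mul] at hi
        exact hne hi.symm
    obtain ⟨g', -, hg'⟩ := h.exists_commutator_eq ⊤ 0 (by simp) (h4 x) hx (Subgroup.mem_top g)
      hnm ((hZ w).mp hw)
    exact hcon ⟨g', hg'⟩
  have hPall : ∀ y : G, y ∉ Subgroup.center G → ∀ g, ⁅y, g⁆ ≠ 1 → ⁅y, g⁆ = y ^ 2 := by
    intro y hy
    obtain ⟨Ψ, hΨ, H⟩ := h.reg.exists_bijective_of_orderOf_eq
      ((h.orderOf_eq (h4 x) hx).trans (h.orderOf_eq (h4 y) hy).symm)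
    intro g
    obtain ⟨g, rfl⟩ := hΨ.2 g
    have h1 := H g ⁅(FreeGroup.of 0 : FreeGroup (Fin 3)), FreeGroup.of 2⁆
    have h2 := H g (⁅(FreeGroup.of 0 : FreeGroup (Fin 3)), FreeGroup.of 2⁆ *
      (FreeGroup.of 0 ^ 2)⁻¹)
    simp only [map_mul, map_inv, map_pow, map_commutatorElement, mul_inv_eq_one,
      FreeGroup.lift_apply_of] at h1 h2
    intro hne
    exact h2.mp (hP g fun he => hne (h1.mp he))
  obtain ⟨a, ha⟩ := hnm
  obtain ⟨b, hab⟩ : ∃ b : G, ⁅a, b⁆ ≠ 1 := by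
    by_contra! hall
    exact ha (mem_center_iff_commutator.mpr hall)
  have hb : b ∉ Subgroup.center G := fun hb => hab (by
    rw [hself, mem_center_iff_commutator.mp hb])
  have hab2 : a ^ 2 = b ^ 2 := by
    rw [← hPall a ha b hab, hself, hPall b hb a (by rwa [hself])]
  -- A `z` with another square commutes with `a` and `b`. Then `⁅a * z, b⁆ = ⁅a, b⁆` must be both `a
  -- ^ 2 * z ^ 2` and `a ^ 2`, so `z ^ 2 = 1`.
  have hall : ∀ z : G, z ∉ Subgroup.center G → z ^ 2 = a ^ 2 := by
    intro z hz
    by_contra hne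
    have haz : ⁅a, z⁆ = 1 := by
      by_contra h1
      exact hne (by rw [← hPall a ha z h1, hself, hPall z hz a (by rwa [hself])])
    have hbz : ⁅b, z⁆ = 1 := by
      by_contra h1
      exact hne (by rw [hab2, ← hPall b hb z h1, hself, hPall z hz b (by rwa [hself])])
    have h1 : (a * z) ^ 2 = a ^ 2 * z ^ 2 := (commutatorElement_eq_one_iff_commute.mp haz).mul_pow 2
    have h2 : a * z ∉ Subgroup.center G := by
      rw [hZ, h1]
      intro h3
      apply hne
      rw [eq_inv_of_mul_eq_one_right h3, inv_eq_iff_mul_eq_one, ← sq]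
      exact (hZ _).mp (hsq a)
    have h3 : ⁅a * z, b⁆ = ⁅a, b⁆ := by
      rw [commutator_mul_left_of_mem_center (hcm _ _), hself z b, hbz, mul_one]
    have h4 := hPall _ h2 b (by rwa [h3])
    rw [h3, h1, hPall a ha b hab, left_eq_mul] at h4
    exact hz ((hZ z).mpr h4)
  have hw1 : w ≠ 1 := by
    rintro rfl
    exact hcon ⟨1, commutatorElement_one_right x⟩
  have hwo : orderOf (a ^ 2) = orderOf w := by
    rw [orderOf_eq_prime ((hZ w).mp hw) hw1, orderOf_eq_prime ((hZ _).mp (hsq a))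
      fun h1 => ha ((hZ a).mpr h1)]
  obtain ⟨z, rfl⟩ := h.reg.exists_root 2 hwo ⟨a, rfl⟩
  have hz : z ∉ Subgroup.center G := fun hz => hw1 ((hZ z).mp hz)
  obtain ⟨g, hg⟩ : ∃ g : G, ⁅x, g⁆ ≠ 1 := by
    by_contra! hall
    exact hx (mem_center_iff_commutator.mpr hall)
  exact hcon ⟨g, by rw [hP g hg, hall x hx, hall z hz]⟩

namespace SquareCentral

variable {G : Type*} [Group G]

lemma commutator_comm (h : SquareCentral G) (x g : G) : ⁅x, g⁆ = ⁅g, x⁆ := by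
  rw [← commutatorElement_inv x g]
  exact eq_inv_of_mul_eq_one_left (by rw [← sq, (h.mem_center_iff _).mp (h.commutator_mem x g)])

lemma commutator_mul_left (h : SquareCentral G) (x y g : G) : ⁅x * y, g⁆ = ⁅x, g⁆ * ⁅y, g⁆ :=
  commutator_mul_left_of_mem_center (h.commutator_mem y g)

lemma commutator_mul_right (h : SquareCentral G) (x y g : G) : ⁅x, y * g⁆ = ⁅x, y⁆ * ⁅x, g⁆ :=
  commutator_mul_right_of_mem_center (h.commutator_mem x g)

lemma mul_sq (h : SquareCentral G) (x y : G) : (x * y) ^ 2 = x ^ 2 * y ^ 2 * ⁅x, y⁆ := by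
  rw [mul_pow_of_commutator_mem_center (h.commutator_mem _ _), Nat.choose_self, pow_one,
    h.commutator_comm]

lemma mul_self_of_mem (h : SquareCentral G) {w : G} (hw : w ∈ Subgroup.center G) : w * w = 1 := by
  rw [← sq]; exact (h.mem_center_iff w).mp hw

lemma sq_ne_one (h : SquareCentral G) {x : G} (hx : x ∉ Subgroup.center G) : x ^ 2 ≠ 1 :=
  fun h1 => hx ((h.mem_center_iff x).mpr h1)

lemma card_centralizer_mul (h : SquareCentral G) {x : G} (hx : x ∉ Subgroup.center G) :
    Nat.card (Subgroup.centralizer {x}) * Nat.card (Subgroup.center G) = Nat.card G := by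
  have hr : (commutatorHom x (h.commutator_mem x)).range = Subgroup.center G := by
    ext w
    constructor
    · rintro ⟨g, rfl⟩
      exact h.commutator_mem x g
    · exact h.exists_commutator x w hx
  rw [← (commutatorHom x (h.commutator_mem x)).ker.card_mul_index, Subgroup.index_ker, hr,
    ker_commutatorHom]

lemma card_commutator_eq (h : SquareCentral G) {x w : G} (hx : x ∉ Subgroup.center G)
    (hw : w ∈ Subgroup.center G) :
    Nat.card {g // ⁅x, g⁆ = w} = Nat.card (Subgroup.centralizer {x}) := by
  obtain ⟨g₀, rfl⟩ := h.exists_commutator x w hx hw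
  refine Nat.card_congr ((Equiv.mulRight g₀⁻¹).subtypeEquiv fun g => ?_)
  have h1 := ker_commutatorHom x (h.commutator_mem x)
  rw [← h1, MonoidHom.mem_ker, Equiv.coe_mulRight, map_mul, map_inv, mul_inv_eq_one]
  rfl

lemma card_sigma_center [Finite G] {T : G → Type*} [∀ g, Finite (T g)] {A B : ℕ}
    (hA : ∀ g ∈ Subgroup.center G, Nat.card (T g) = A)
    (hB : ∀ g ∉ Subgroup.center G, Nat.card (T g) = B) :
    Nat.card (Σ g, T g) = Nat.card (Subgroup.center G) * A +
      (Nat.card G - Nat.card (Subgroup.center G)) * B := by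
  classical
  have := Fintype.ofFinite G
  rw [Nat.card_sigma, ← Finset.sum_filter_add_sum_filter_not _ (· ∈ Subgroup.center G),
    Finset.sum_congr (s₁ := Finset.univ.filter (· ∈ Subgroup.center G)) rfl (g := fun _ => A),
    Finset.sum_congr (s₁ := Finset.univ.filter (· ∉ Subgroup.center G)) rfl (g := fun _ => B),
    Finset.sum_const, Finset.sum_const]
  · simp only [smul_eq_mul]
    have h1 : (Finset.univ.filter (· ∈ Subgroup.center G)).card =
        Nat.card (Subgroup.center G) := by
      rw [Nat.card_eq_fintype_card, Fintype.card_subtype]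
    have h2 := Finset.card_filter_add_card_filter_not (s := (Finset.univ : Finset G))
      (· ∈ Subgroup.center G)
    rw [h1, Finset.card_univ, ← Nat.card_eq_fintype_card] at h2
    rw [h1, ← h2, Nat.add_sub_cancel_left]
  · intro g hg
    exact hB g (Finset.mem_filter.mp hg).2
  · intro g hg
    exact hA g (Finset.mem_filter.mp hg).2

lemma card_roots (h : SquareCentral G) {w w' : G} (hw : w ∈ Subgroup.center G)
    (hw' : w' ∈ Subgroup.center G) (hw1 : w ≠ 1) (hw1' : w' ≠ 1) :
    Nat.card {g : G // g ^ 2 = w} = Nat.card {g : G // g ^ 2 = w'} := by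
  refine h.reg.card_roots 2 ?_
  rw [orderOf_eq_prime ((h.mem_center_iff w).mp hw) hw1,
    orderOf_eq_prime ((h.mem_center_iff w').mp hw') hw1']

lemma card_sq_eq_one (h : SquareCentral G) :
    Nat.card {g : G // g ^ 2 = 1} = Nat.card (Subgroup.center G) :=
  Nat.card_congr (Equiv.subtypeEquivRight fun g => (h.mem_center_iff g).symm)

/-- The number of pairs of elements with the same square, counted in two ways, determines the
orders of the group and of its centralizers. -/
lemma card_eq [Finite G] (h : SquareCentral G) {x : G} (hx : x ∉ Subgroup.center G) :
    Nat.card (Subgroup.centralizer {x}) = Nat.card (Subgroup.center G) ^ 2 ∧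
    Nat.card {g : G // g ^ 2 = x ^ 2} =
      Nat.card (Subgroup.center G) ^ 2 + Nat.card (Subgroup.center G) := by
  have hx2 := h.sq_ne_one hx
  have h1 := card_eq_of_card_fiber (fun g : G => g ^ 2) (Subgroup.center G) h.sq_mem
    fun w hw hw1 => h.card_roots hw (h.sq_mem x) hw1 hx2
  rw [h.card_sq_eq_one] at h1
  have h2 := card_sigma_center (T := fun g : G => {u : G // u ^ 2 = g ^ 2})
    (A := Nat.card (Subgroup.center G)) (B := Nat.card {g : G // g ^ 2 = x ^ 2})
    (fun g hg => by rw [(h.mem_center_iff g).mp hg, h.card_sq_eq_one])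
    (fun g hg => h.card_roots (h.sq_mem g) (h.sq_mem x) (h.sq_ne_one hg) hx2)
  have h3 := card_sigma_center (T := fun u : G => {g : G // ⁅u, g⁆ = u ^ 2})
    (A := Nat.card G) (B := Nat.card (Subgroup.centralizer {x}))
    (fun u hu => by
      rw [(h.mem_center_iff u).mp hu]
      exact Nat.card_congr (Equiv.subtypeUnivEquiv (mem_center_iff_commutator.mp hu)))
    (fun u hu => by
      rw [h.card_commutator_eq hu (h.sq_mem u)]
      exact Nat.eq_of_mul_eq_mul_right Nat.card_pos
        ((h.card_centralizer_mul hu).trans (h.card_centralizer_mul hx).symm))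
  -- Two elements with the same square are written as `u * g` and `g`; their squares agree exactly
  -- when `u` satisfies `⁅u, g⁆ = u ^ 2`.
  have h4 : Nat.card (Σ g : G, {u : G // u ^ 2 = g ^ 2}) =
      Nat.card (Σ u : G, {g : G // ⁅u, g⁆ = u ^ 2}) := by
    have key : ∀ u g : G, (u * g) ^ 2 = g ^ 2 ↔ ⁅u, g⁆ = u ^ 2 := by
      intro u g
      rw [h.mul_sq, ← Subgroup.mem_center_iff.mp (h.sq_mem u), mul_assoc, mul_eq_left,
        mul_eq_one_iff_inv_eq, inv_eq_of_mul_eq_one_right (h.mul_self_of_mem (h.sq_mem u)), eq_comm]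
    refine Nat.card_congr ⟨fun t => ⟨t.2.1 * t.1⁻¹, t.1, ?_⟩, fun t => ⟨t.2.1, t.1 * t.2.1, ?_⟩,
      fun t => ?_, fun t => ?_⟩
    · rw [← key, inv_mul_cancel_right, t.2.2]
    · exact (key _ _).mpr t.2.2
    · obtain ⟨g, u, hu⟩ := t
      exact Sigma.subtype_ext rfl (by simp)
    · obtain ⟨g, u, hu⟩ := t
      exact Sigma.subtype_ext (by simp) rfl
  have h5 := h.card_centralizer_mul hx
  have h6 : 2 ≤ Nat.card (Subgroup.center G) := by
    have : Nontrivial (Subgroup.center G) :=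
      ⟨⟨x ^ 2, h.sq_mem x⟩, 1, fun he => hx2 (congrArg Subtype.val he)⟩
    exact Finite.one_lt_card
  have h7 : 0 < Nat.card {g : G // g ^ 2 = x ^ 2} :=
    have : Nonempty {g : G // g ^ 2 = x ^ 2} := ⟨⟨x, rfl⟩⟩
    Nat.card_pos
  rw [h2, h3] at h4
  generalize Nat.card {g : G // g ^ 2 = x ^ 2} = r at *
  generalize Nat.card (Subgroup.centralizer {x}) = c at *
  generalize Nat.card G = n at *
  generalize Nat.card (Subgroup.center G) = z at *
  obtain ⟨y, rfl⟩ : ∃ y, z = y + 1 := ⟨z - 1, by omega⟩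
  rw [h1, Nat.add_sub_cancel_left, Nat.add_sub_cancel] at h4
  rw [h1, Nat.add_sub_cancel] at h5
  -- With `z` the order of the centre, the double count reads `z ^ 2 + (n - z) * r = z * n + (n - z)
  -- * c`. Inserting `n = z + (z - 1) * r` leaves `r = c + z`, and then `n = c * z` gives `c = z ^
  -- 2`.
  have h8 : y * r * (c + (y + 1)) = y * r * r := by linarith
  have h9 : c + (y + 1) = r := Nat.eq_of_mul_eq_mul_left (Nat.mul_pos (by omega) h7) h8
  subst h9
  have h10 : c = (y + 1) ^ 2 := by nlinarith
  exact ⟨h10, by rw [h10]⟩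

end SquareCentral

/-! ### Recognition of the quaternion group. -/

section Quaternion

lemma nonempty_mulEquiv_quaternionGroup {G : Type*} [Group G] (hG : Nat.card G = 8) {x y : G}
    (hx : orderOf x = 4) (hy : y ^ 2 = x ^ 2) (hxy : ⁅x, y⁆ = x ^ 2) :
    Nonempty (G ≃* QuaternionGroup 2) := by
  have hx4 : x ^ (4 : ℤ) = 1 := by
    have := pow_orderOf_eq_one x
    rw [hx] at this
    exact_mod_cast this
  let e : ZMod 4 →+ Additive G := ZMod.lift 4 ⟨zmultiplesHom (Additive G) (Additive.ofMul x), by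
    rw [zmultiplesHom_apply, ← ofMul_zpow]
    exact congrArg Additive.ofMul hx4⟩
  let X : ZMod 4 → G := fun i => (e i).toMul
  have hXadd : ∀ i j, X (i + j) = X i * X j := fun i j => by
    simp only [X, map_add, toMul_add]
  have hXint : ∀ n : ℤ, X n = x ^ n := fun n => by
    simp only [X, e, ZMod.lift_coe, zmultiplesHom_apply]
    rfl
  have hconj : x * y = y * x⁻¹ := by
    have h1 : x * y = x ^ 2 * (y * x) := by rw [← hxy, commutatorElement_def]; group
    have h2 : x ^ 2 * y = y * x ^ 2 := by rw [← hy]; group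
    have h3 : x ^ 2 * x = x⁻¹ := by
      rw [eq_inv_iff_mul_eq_one, mul_assoc, ← sq, ← pow_add]
      exact_mod_cast hx4
    rw [h1, ← mul_assoc, h2, mul_assoc, h3]
  have hXy : ∀ i, X i * y = y * X (-i) := by
    intro i
    obtain ⟨n, rfl⟩ := ZMod.intCast_surjective i
    rw [← Int.cast_neg, hXint, hXint, zpow_neg, ← inv_zpow]
    have : SemiconjBy y x⁻¹ x := hconj.symm
    exact (this.zpow_right n).eq.symm
  have hX2 : X 2 = y * y := by
    have := hXint 2
    rw [← sq, hy]
    exact_mod_cast this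
  let f : QuaternionGroup 2 →* G := MonoidHom.mk' (fun q => match q with
    | .a i => X i
    | .xa i => y * X i) (by
      rintro (i | i) (j | j)
      · exact hXadd i j
      · change y * X (j - i) = X i * (y * X j)
        rw [← mul_assoc, hXy, mul_assoc, ← hXadd, neg_add_eq_sub]
      · change y * X (i + j) = y * X i * X j
        rw [hXadd, mul_assoc]
      · change X (2 + j - i) = y * X i * (y * X j)
        rw [← mul_assoc, mul_assoc y, hXy, ← mul_assoc, ← hX2, ← hXadd, ← hXadd]
        congr 1
        ring)
  have hinj : Function.Injective f := by
    rw [injective_iff_map_eq_one]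
    rintro (i | i) hi
    · change X i = 1 at hi
      obtain ⟨n, rfl⟩ := ZMod.intCast_surjective i
      rw [hXint, ← orderOf_dvd_iff_zpow_eq_one, hx] at hi
      have : ((n : ZMod 4)) = 0 := (ZMod.intCast_zmod_eq_zero_iff_dvd n 4).mpr hi
      exact congrArg (QuaternionGroup.a (n := 2)) this
    · exfalso
      change y * X i = 1 at hi
      obtain ⟨n, rfl⟩ := ZMod.intCast_surjective i
      rw [hXint, mul_eq_one_iff_eq_inv, ← zpow_neg] at hi
      have hc : Commute x y := hi ▸ (Commute.refl x).zpow_right _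
      rw [hc.commutator_eq] at hxy
      have := orderOf_dvd_of_pow_eq_one hxy.symm
      rw [hx] at this
      omega
  have hfin : Finite G := Nat.finite_of_card_ne_zero (by omega)
  have hcard : Nat.card (QuaternionGroup 2) = Nat.card G := by
    rw [hG, Nat.card_eq_fintype_card, QuaternionGroup.card]
  exact ⟨(MulEquiv.ofBijective f
    (hinj.bijective_of_nat_card_le hcard.ge)).symm⟩

end Quaternion

/-! ### The order of the centre. -/

namespace SquareCentral

variable {G : Type*} [Group G]

lemma orderOf_eq (h : SquareCentral G) {x : G} (hx : x ∉ Subgroup.center G) : orderOf x = 4 :=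
  orderOf_eq_prime_pow (p := 2) (n := 1) (h.sq_ne_one hx) (by
    have := (h.mem_center_iff _).mp (h.sq_mem x)
    rwa [← pow_mul] at this)

lemma card_eq_pow_three [Finite G] (h : SquareCentral G) :
    Nat.card G = Nat.card (Subgroup.center G) ^ 3 := by
  obtain ⟨x, hx⟩ := h.exists_notMem
  rw [← h.card_centralizer_mul hx, (h.card_eq hx).1, ← pow_succ]

lemma notMem_center_of_commutator_eq_sq (h : SquareCentral G) {x g : G} (hx : x ∉ Subgroup.center G)
    (hg : ⁅x, g⁆ = x ^ 2) : g ∉ Subgroup.center G := fun hgZ =>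
  h.sq_ne_one hx (by rw [← hg, h.commutator_comm, mem_center_iff_commutator.mp hgZ])

lemma mulEquiv_quaternionGroup [Finite G] (h : SquareCentral G)
    (hZ : Nat.card (Subgroup.center G) = 2) : Nonempty (G ≃* QuaternionGroup 2) := by
  obtain ⟨x, hx⟩ := h.exists_notMem
  obtain ⟨g, hg⟩ := h.exists_commutator x (x ^ 2) hx (h.sq_mem x)
  refine nonempty_mulEquiv_quaternionGroup (by rw [h.card_eq_pow_three, hZ]; norm_num)
    (h.orderOf_eq hx) ?_ hg
  have hgZ := h.notMem_center_of_commutator_eq_sq hx hg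
  obtain ⟨w, hw, hw'⟩ := (Nat.card_eq_two_iff' (1 : Subgroup.center G)).mp hZ
  have h1 := hw' ⟨g ^ 2, h.sq_mem g⟩ fun he => h.sq_ne_one hgZ (congrArg Subtype.val he)
  have h2 := hw' ⟨x ^ 2, h.sq_mem x⟩ fun he => h.sq_ne_one hx (congrArg Subtype.val he)
  exact congrArg Subtype.val (h1.trans h2.symm)

lemma exists_quaternion_pair (h : SquareCentral G) {x y : G} (hx : x ∉ Subgroup.center G)
    (hy : y ∉ Subgroup.center G) (hg : ∃ g, ⁅x, g⁆ = x ^ 2 ∧ g ^ 2 = x ^ 2) :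
    ∃ g, ⁅y, g⁆ = y ^ 2 ∧ g ^ 2 = y ^ 2 := by
  obtain ⟨Ψ, hΨ, H⟩ := h.reg.exists_bijective_of_orderOf_eq
    ((h.orderOf_eq hx).trans (h.orderOf_eq hy).symm)
  obtain ⟨g, hg1, hg2⟩ := hg
  have h1 := H g (⁅(FreeGroup.of 0 : FreeGroup (Fin 3)), FreeGroup.of 2⁆ *
      (FreeGroup.of 0 ^ 2)⁻¹)
  have h2 := H g (FreeGroup.of 2 ^ 2 * (FreeGroup.of 0 ^ 2)⁻¹)
  simp only [map_mul, map_inv, map_pow, map_commutatorElement, mul_inv_eq_one,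
    FreeGroup.lift_apply_of] at h1 h2
  exact ⟨Ψ g, h1.mp hg1, h2.mp hg2⟩

/-- If an element inverting `x` has a square different from `x ^ 2`, then the centre has order at
most four, and it has order less than four if there also is one with the same square. -/
lemma card_center_le [Finite G] (h : SquareCentral G) {x g : G} (hx : x ∉ Subgroup.center G)
    (hg : ⁅x, g⁆ = x ^ 2) (hgx : g ^ 2 ≠ x ^ 2) :
    Nat.card (Subgroup.center G) ≤ 4 ∧ (Nat.card (Subgroup.center G) = 4 →
      ¬ ∃ g, ⁅x, g⁆ = x ^ 2 ∧ g ^ 2 = x ^ 2) := by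
  classical
  have := Fintype.ofFinite G
  have hx2 := h.sq_ne_one hx
  set z := Nat.card (Subgroup.center G) with hz
  let D : G → ℕ := fun w => Nat.card {g // ⁅x, g⁆ = x ^ 2 ∧ g ^ 2 = w}
  have hsum : z ^ 2 = ∑ w : Subgroup.center G, D w := by
    rw [hz, ← (h.card_eq hx).1, ← h.card_commutator_eq hx (h.sq_mem x), ← Nat.card_sigma]
    refine Nat.card_congr ((Equiv.sigmaFiberEquiv (fun g : {g // ⁅x, g⁆ = x ^ 2} =>
      (⟨(g : G) ^ 2, h.sq_mem g⟩ : Subgroup.center G))).symm.trans ?_)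
    refine Equiv.sigmaCongrRight fun w => ?_
    refine (Equiv.subtypeEquivRight (q := fun g : {g // ⁅x, g⁆ = x ^ 2} => (g : G) ^ 2 = w)
      fun g => Subtype.ext_iff).trans ?_
    exact Equiv.subtypeSubtypeEquivSubtypeInter (fun g => ⁅x, g⁆ = x ^ 2) (fun g => g ^ 2 = w)
  have hzp : ∀ w, w ^ 2 = 1 → w ≠ 1 → w ≠ x ^ 2 → w ∉ Subgroup.zpowers x := by
    rintro w hw hw1 hwx ⟨i, rfl⟩
    simp only at hw hw1 hwx
    have h4 : x ^ (4 : ℤ) = 1 := by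
      have := pow_orderOf_eq_one x
      rw [h.orderOf_eq hx] at this
      exact_mod_cast this
    rw [← zpow_natCast, ← zpow_mul, ← orderOf_dvd_iff_zpow_eq_one, h.orderOf_eq hx] at hw
    obtain ⟨j, hj⟩ := hw
    obtain ⟨l, rfl | rfl⟩ := Int.even_or_odd' j
    · have : i = 4 * l := by push_cast at hj; omega
      exact hw1 (by rw [this, zpow_mul, h4, one_zpow])
    · have : i = 4 * l + 2 := by push_cast at hj; omega
      exact hwx (by rw [this, zpow_add, zpow_mul, h4, one_zpow, one_mul]; exact_mod_cast rfl)
  have hcomm : ∀ w : G, w ^ 2 = 1 → Commute x w := fun w hw =>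
    Subgroup.mem_center_iff.mp ((h.mem_center_iff w).mpr hw) x
  have hgZ := h.notMem_center_of_commutator_eq_sq hx hg
  have hgs : (g ^ 2) ^ 2 = 1 := (h.mem_center_iff _).mp (h.sq_mem g)
  -- The elements `g * c` and `x * g * c` with `c` central all invert `x` and have the square of
  -- `g`.
  have hDg : 2 * z ≤ D (g ^ 2) := by
    have e : Nat.card (Bool × Subgroup.center G) = 2 * z := by
      rw [Nat.card_prod, Nat.card_eq_fintype_card, Fintype.card_bool]
    rw [← e]
    have hxc : ∀ c ∈ Subgroup.center G, ⁅x, c⁆ = 1 := fun c hc => by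
      rw [h.commutator_comm]; exact mem_center_iff_commutator.mp hc x
    refine Nat.card_le_card_of_injective (fun t => ⟨(if t.1 then x * g else g) * t.2, ?_, ?_⟩) ?_
    · rw [h.commutator_mul_right, hxc _ t.2.2, mul_one]
      split_ifs
      · rw [h.commutator_mul_right, commutatorElement_self, one_mul, hg]
      · exact hg
    · rw [h.mul_sq, (h.mem_center_iff _).mp t.2.2, h.commutator_comm _ (t.2 : G),
        mem_center_iff_commutator.mp t.2.2, mul_one, mul_one]
      split_ifs
      · rw [h.mul_sq, hg, Subgroup.mem_center_iff.mp (h.sq_mem x), ← mul_assoc,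
          h.mul_self_of_mem (h.sq_mem x), one_mul]
      · rfl
    · rintro ⟨b, c⟩ ⟨b', c'⟩ hbc
      have hbc' := congrArg Subtype.val hbc
      simp only at hbc'
      have hkey : ∀ u v : Subgroup.center G, x * g * u ≠ g * v := by
        intro u v huv
        have h1 : x = g * (v * (u : G)⁻¹) * g⁻¹ := by
          rw [← mul_assoc, ← huv]; group
        rw [Subgroup.mem_center_iff.mp (mul_mem v.2 (inv_mem u.2)) g, mul_inv_cancel_right] at h1
        exact hx (h1 ▸ mul_mem v.2 (inv_mem u.2))
      cases b <;> cases b' <;> simp at hbc'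
      · rw [hbc']
      · exact absurd hbc'.symm (hkey _ _)
      · exact absurd hbc' (hkey _ _)
      · rw [hbc']
  have hD : ∀ w, w ^ 2 = 1 → w ≠ 1 → w ≠ x ^ 2 → 2 * z ≤ D w := by
    intro w hw hw1 hwx
    have hgz := hzp _ hgs (h.sq_ne_one hgZ) hgx
    rw [show D w = D (g ^ 2) from h.reg.card_commutator_sq (hcomm w hw) (hcomm _ hgs) hw hgs
      (hzp w hw hw1 hwx) hgz]
    exact hDg
  -- The `z - 2` central elements other than `1` and `x ^ 2` have the same type over `x`, so each is
  -- the square of at least `2 * z` of the `z ^ 2` elements inverting `x`.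
  have hbig : D (x ^ 2) + (z - 2) * (2 * z) ≤ z ^ 2 := by
    let a : Subgroup.center G := ⟨x ^ 2, h.sq_mem x⟩
    have ha1 : (1 : Subgroup.center G) ∈ Finset.univ.erase a := by
      rw [Finset.mem_erase]
      exact ⟨fun he => hx2 (congrArg Subtype.val he).symm, Finset.mem_univ _⟩
    rw [hsum, ← Finset.add_sum_erase _ _ (Finset.mem_univ a), ← Finset.add_sum_erase _ _ ha1]
    refine Nat.add_le_add_left (le_trans ?_ (Nat.le_add_left _ _)) _
    have hc : ((Finset.univ.erase a).erase 1).card = z - 2 := by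
      rw [Finset.card_erase_of_mem ha1, Finset.card_erase_of_mem (Finset.mem_univ _),
        Finset.card_univ, hz, Nat.card_eq_fintype_card]
      rfl
    rw [← hc, ← smul_eq_mul]
    refine Finset.card_nsmul_le_sum _ _ _ fun w hw => ?_
    simp only [Finset.mem_erase] at hw
    exact hD w ((h.mem_center_iff _).mp w.2) (fun he => hw.1 (Subtype.ext he))
      (fun he => hw.2.1 (Subtype.ext he))
  constructor
  · by_contra! hlt
    obtain ⟨y, hy⟩ : ∃ y, z = y + 5 := ⟨z - 5, by omega⟩
    rw [hy] at hbig
    have : y + 5 - 2 = y + 3 := rfl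
    rw [this] at hbig
    nlinarith
  · rintro h4 ⟨g', hg'⟩
    rw [h4] at hbig
    have : 0 < D (x ^ 2) :=
      have : Nonempty {g // ⁅x, g⁆ = x ^ 2 ∧ g ^ 2 = x ^ 2} := ⟨⟨g', hg'⟩⟩
      Nat.card_pos
    omega

/-- If every element inverting a noncentral element `x` has square `x ^ 2`, then the elements with
that square and the centre form a subgroup, and the centre has order two. -/
lemma card_center_eq_two [Finite G] (h : SquareCentral G) (hp : IsPGroup 2 G)
    (hall : ∀ x g : G, x ∉ Subgroup.center G → ⁅x, g⁆ = x ^ 2 → g ^ 2 = x ^ 2) :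
    Nat.card (Subgroup.center G) = 2 := by
  obtain ⟨x, hx⟩ := h.exists_notMem
  have hx2 := h.sq_ne_one hx
  -- The `|Z| ^ 2` elements inverting `y` and the coset `y * Z` are disjoint sets of roots of `y ^
  -- 2`. There are only `|Z| ^ 2 + |Z|` roots, so these are all of them.
  have hF : ∀ y g : G, y ∉ Subgroup.center G → g ^ 2 = y ^ 2 → ⁅y, g⁆ = 1 ∨ ⁅y, g⁆ = y ^ 2 := by
    intro y g hy hg
    let f : {g : G // ⁅y, g⁆ = y ^ 2} ⊕ Subgroup.center G → {g : G // g ^ 2 = y ^ 2} :=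
      Sum.elim (fun g => ⟨g, hall y g hy g.2⟩) (fun c => ⟨y * c, by
        rw [h.mul_sq, (h.mem_center_iff _).mp c.2, h.commutator_comm,
          mem_center_iff_commutator.mp c.2, mul_one, mul_one]⟩)
    have hyc : ∀ c : Subgroup.center G, ⁅y, y * c⁆ = 1 := fun c => by
      rw [h.commutator_mul_right, commutatorElement_self, one_mul, h.commutator_comm,
        mem_center_iff_commutator.mp c.2]
    have hf : Function.Injective f := by
      refine Function.Injective.sumElim ?_ ?_ ?_
      · intro a b hab
        exact Subtype.ext (congrArg (Subtype.val : {g : G // g ^ 2 = y ^ 2} → G) hab)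
      · intro a b hab
        exact Subtype.ext (mul_left_cancel
          (congrArg (Subtype.val : {g : G // g ^ 2 = y ^ 2} → G) hab))
      · intro a b hab
        have hab' : (a : G) = y * b := congrArg (Subtype.val : {g : G // g ^ 2 = y ^ 2} → G) hab
        have h1 := a.2
        rw [hab', hyc] at h1
        exact h.sq_ne_one hy h1.symm
    have hcard : Nat.card {g : G // g ^ 2 = y ^ 2} ≤
        Nat.card ({g : G // ⁅y, g⁆ = y ^ 2} ⊕ Subgroup.center G) := by
      rw [Nat.card_sum, h.card_commutator_eq hy (h.sq_mem y), (h.card_eq hy).1, (h.card_eq hy).2]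
    obtain ⟨a | c, hac⟩ := (hf.bijective_of_nat_card_le hcard).2 ⟨g, hg⟩
    · have : (a : G) = g := congrArg Subtype.val hac
      exact Or.inr (this ▸ a.2)
    · have : y * (c : G) = g := congrArg Subtype.val hac
      exact Or.inl (this ▸ hyc c)
  have hxx : x ^ 2 * x ^ 2 = 1 := h.mul_self_of_mem (h.sq_mem x)
  let H : Subgroup G :=
    { carrier := {g | g ^ 2 = 1 ∨ g ^ 2 = x ^ 2}
      one_mem' := Or.inl (one_pow 2)
      inv_mem' := by
        rintro g (hg | hg)
        · exact Or.inl (by rw [inv_pow, hg, inv_one])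
        · exact Or.inr (by rw [inv_pow, hg, inv_eq_of_mul_eq_one_right hxx])
      mul_mem' := by
        rintro a b ha hb
        rw [Set.mem_ofPred_eq] at *
        rw [h.mul_sq]
        by_cases haZ : a ∈ Subgroup.center G
        · rw [mem_center_iff_commutator.mp haZ, (h.mem_center_iff a).mp haZ, one_mul, mul_one]
          exact hb
        by_cases hbZ : b ∈ Subgroup.center G
        · rw [h.commutator_comm, mem_center_iff_commutator.mp hbZ, (h.mem_center_iff b).mp hbZ,
            mul_one, mul_one]
          exact ha
        have ha' := ha.resolve_left (h.sq_ne_one haZ)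
        have hb' := hb.resolve_left (h.sq_ne_one hbZ)
        rw [ha', hb', hxx, one_mul, ← ha']
        exact hF a b haZ (hb'.trans ha'.symm) }
  have hH : Nat.card H = Nat.card (Subgroup.center G) * (Nat.card (Subgroup.center G) + 2) := by
    classical
    have hd : Disjoint (fun g : G => g ^ 2 = 1) (fun g => g ^ 2 = x ^ 2) := by
      rw [disjoint_iff_inf_le]
      rintro g ⟨h1, h2⟩
      exact hx2 (h2.symm.trans h1)
    have e : H ≃ {g : G // g ^ 2 = 1} ⊕ {g : G // g ^ 2 = x ^ 2} :=
      subtypeOrEquiv _ _ hd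
    rw [Nat.card_congr e, Nat.card_sum, h.card_sq_eq_one, (h.card_eq hx).2]
    ring
  obtain ⟨i, hi⟩ := IsPGroup.iff_card.mp (hp.to_subgroup H)
  obtain ⟨j, hj⟩ := IsPGroup.iff_card.mp (hp.to_subgroup (Subgroup.center G))
  have h6 : 2 ≤ Nat.card (Subgroup.center G) := by
    have : Nontrivial (Subgroup.center G) :=
      ⟨⟨x ^ 2, h.sq_mem x⟩, 1, fun he => hx2 (congrArg Subtype.val he)⟩
    exact Finite.one_lt_card
  -- Both `|Z|` and `|Z| + 2` are powers of two, which leaves only `|Z| = 2`.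
  obtain ⟨l, -, hl⟩ := (Nat.dvd_prime_pow Nat.prime_two).mp
    (hi ▸ hH ▸ Dvd.intro_left _ rfl : Nat.card (Subgroup.center G) + 2 ∣ 2 ^ i)
  by_contra hne
  have hj2 : 2 ≤ j := by
    by_contra hlt
    interval_cases j <;> omega
  have hl2 : 2 ≤ l := by
    by_contra hlt
    interval_cases l <;> omega
  have h7 : 4 ∣ Nat.card (Subgroup.center G) := hj ▸ pow_dvd_pow 2 hj2
  have h8 : 4 ∣ Nat.card (Subgroup.center G) + 2 := hl ▸ pow_dvd_pow 2 hl2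
  omega

lemma card_center [Finite G] (h : SquareCentral G) (hp : IsPGroup 2 G) :
    Nat.card (Subgroup.center G) = 2 ∨ (Nat.card (Subgroup.center G) = 4 ∧
      ∀ x g : G, x ∉ Subgroup.center G → ⁅x, g⁆ = x ^ 2 → g ^ 2 ≠ x ^ 2) := by
  by_cases hall : ∀ x g : G, x ∉ Subgroup.center G → ⁅x, g⁆ = x ^ 2 → g ^ 2 = x ^ 2
  · exact Or.inl (h.card_center_eq_two hp hall)
  push Not at hall
  obtain ⟨x, g, hx, hg, hgx⟩ := hall
  obtain ⟨h1, h2⟩ := h.card_center_le hx hg hgx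
  obtain ⟨j, hj⟩ := IsPGroup.iff_card.mp (hp.to_subgroup (Subgroup.center G))
  have hj2 : j ≤ 2 := by
    rw [hj] at h1
    exact (Nat.pow_le_pow_iff_right (a := 2) (by norm_num)).mp h1
  have hj0 : j ≠ 0 := by
    rintro rfl
    rw [pow_zero, Subgroup.card_eq_one] at hj
    have := h.sq_mem x
    rw [hj, Subgroup.mem_bot] at this
    exact h.sq_ne_one hx this
  obtain rfl | rfl : j = 1 ∨ j = 2 := by omega
  · exact Or.inl hj
  · exact Or.inr ⟨hj, fun y g' hy h3 h4 => h2 hj (h.exists_quaternion_pair hy hx ⟨g', h3, h4⟩)⟩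

end SquareCentral

/-! ### Suzuki relations, normal forms and comparison of groups. -/

/-- Relations satisfied by suitable generators of the Suzuki `2`-group of order `64`. -/
structure SuzukiRelations {A : Type*} [Group A] (x₁ x₂ y₁ y₂ w₁ w₂ : A) : Prop where
  center₁ : w₁ ∈ Subgroup.center A
  center₂ : w₂ ∈ Subgroup.center A
  sq_w₁ : w₁ ^ 2 = 1
  sq_w₂ : w₂ ^ 2 = 1
  sq_x₁ : x₁ ^ 2 = w₁
  sq_x₂ : x₂ ^ 2 = w₂
  sq_y₁ : y₁ ^ 2 = w₁
  sq_y₂ : y₂ ^ 2 = w₂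
  comm_x : ⁅x₁, x₂⁆ = 1
  comm_y : ⁅y₁, y₂⁆ = 1
  comm₁₁ : ⁅x₁, y₁⁆ = w₂
  comm₁₂ : ⁅x₁, y₂⁆ = w₁
  comm₂₁ : ⁅x₂, y₁⁆ = w₁
  comm₂₂ : ⁅x₂, y₂⁆ = w₁ * w₂

/-- The two distinguished central involutions are independent. -/
structure IndependentInvolutions {A : Type*} [Group A] (w₁ w₂ : A) : Prop where
  ne₁ : w₁ ≠ 1
  ne₂ : w₂ ≠ 1
  ne : w₁ * w₂ ≠ 1

lemma pow_eq_one_of_even {A : Type*} [Group A] {w : A} (hw : w ^ 2 = 1) {n : ℕ} (hn : Even n) :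
    w ^ n = 1 := by
  obtain ⟨m, rfl⟩ := hn
  rw [← two_mul, pow_mul, hw, one_pow]

lemma pow_eq_self_of_odd {A : Type*} [Group A] {w : A} (hw : w ^ 2 = 1) {n : ℕ} (hn : Odd n) :
    w ^ n = w := by
  obtain ⟨m, rfl⟩ := hn
  rw [pow_succ, pow_mul, hw, one_pow, one_mul]

lemma IndependentInvolutions.even {A : Type*} [Group A] {w₁ w₂ : A}
    (h : IndependentInvolutions w₁ w₂) (h₁ : w₁ ^ 2 = 1) (h₂ : w₂ ^ 2 = 1) {m n : ℕ}
    (hmn : w₁ ^ m * w₂ ^ n = 1) : Even m ∧ Even n := by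
  rcases Nat.even_or_odd m with hm | hm <;> rcases Nat.even_or_odd n with hn | hn
  · exact ⟨hm, hn⟩
  · rw [pow_eq_one_of_even h₁ hm, pow_eq_self_of_odd h₂ hn, one_mul] at hmn
    exact absurd hmn h.ne₂
  · rw [pow_eq_self_of_odd h₁ hm, pow_eq_one_of_even h₂ hn, mul_one] at hmn
    exact absurd hmn h.ne₁
  · rw [pow_eq_self_of_odd h₁ hm, pow_eq_self_of_odd h₂ hn] at hmn
    exact absurd hmn h.ne

namespace SuzukiRelations

variable {A : Type*} [Group A] {x₁ x₂ y₁ y₂ w₁ w₂ : A}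

lemma inv_w₁ (h : SuzukiRelations x₁ x₂ y₁ y₂ w₁ w₂) : w₁⁻¹ = w₁ :=
  inv_eq_of_mul_eq_one_right (by rw [← sq, h.sq_w₁])

lemma inv_w₂ (h : SuzukiRelations x₁ x₂ y₁ y₂ w₁ w₂) : w₂⁻¹ = w₂ :=
  inv_eq_of_mul_eq_one_right (by rw [← sq, h.sq_w₂])

lemma exists_eq_prod [Finite A] (h : SuzukiRelations x₁ x₂ y₁ y₂ w₁ w₂) {g : A}
    (hg : g ∈ Subgroup.closure {x₁, x₂, y₁, y₂}) : ∃ a b c d e f : ℕ,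
      g = x₁ ^ a * x₂ ^ b * y₁ ^ c * y₂ ^ d * w₁ ^ e * w₂ ^ f := by
  have hw : ∀ e f : ℕ, w₁ ^ e * w₂ ^ f ∈ Subgroup.center A := fun e f =>
    mul_mem (pow_mem h.center₁ e) (pow_mem h.center₂ f)
  have hmul : ∀ e f e' f' : ℕ, (w₁ ^ e * w₂ ^ f) * (w₁ ^ e' * w₂ ^ f') =
      w₁ ^ (e + e') * w₂ ^ (f + f') := by
    intro e f e' f'
    rw [pow_add, pow_add, mul_assoc, ← mul_assoc (w₂ ^ f),
      Subgroup.mem_center_iff.mp (pow_mem h.center₁ e')]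
    simp only [mul_assoc]
  have hswap : ∀ {x y : A} {e f : ℕ}, ⁅x, y⁆ = w₁ ^ e * w₂ ^ f → ∀ n : ℕ, ∃ e f : ℕ,
      y ^ n * x = x * y ^ n * (w₁ ^ e * w₂ ^ f) := by
    intro x y e f hxy n
    have hinv : ⁅y, x⁆ = w₁ ^ e * w₂ ^ f := by
      rw [← commutatorElement_inv, hxy, mul_inv_rev, ← inv_pow, ← inv_pow, h.inv_w₁, h.inv_w₂,
        Subgroup.mem_center_iff.mp (pow_mem h.center₁ e)]
    have hc : ⁅y, x⁆ ∈ Subgroup.center A := hinv ▸ hw e f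
    refine ⟨e * n, f * n, ?_⟩
    have h1 := commutator_pow_left_of_mem_center hc n
    rw [hinv, Commute.mul_pow (Subgroup.mem_center_iff.mp (pow_mem h.center₂ f) (w₁ ^ e)),
      ← pow_mul, ← pow_mul] at h1
    rw [Subgroup.mem_center_iff.mp (hw _ _) (x * y ^ n), ← h1, commutatorElement_def]
    group
  have hmove : ∀ {P Y Z n₁ n₂ u : A}, n₁ ∈ Subgroup.center A → Y * u = u * Y * n₁ →
      Z * u = u * Z * n₂ → P * Y * Z * u = P * u * Y * Z * (n₁ * n₂) := by
    intro P Y Z n₁ n₂ u hn hY hZ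
    calc P * Y * Z * u = P * (Y * u) * Z * n₂ := by rw [mul_assoc _ Z, hZ]; simp only [mul_assoc]
      _ = P * u * Y * (n₁ * Z) * n₂ := by rw [hY]; simp only [mul_assoc]
      _ = _ := by rw [← Subgroup.mem_center_iff.mp hn Z]; simp only [mul_assoc]
  suffices H : ∃ a b c d e f : ℕ, g = x₁ ^ a * x₂ ^ b * y₁ ^ c * y₂ ^ d * (w₁ ^ e * w₂ ^ f) by
    simpa only [mul_assoc] using H
  -- In a finite group the generators already generate as a monoid, so only right multiplication by
  -- a generator has to be collected.
  rw [← Subgroup.mem_toSubmonoid, Subgroup.closure_toSubmonoid_of_finite] at hg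
  have hx₁ : Commute x₁ x₂ := commutatorElement_eq_one_iff_commute.mp h.comm_x
  have hy₁ : Commute y₁ y₂ := commutatorElement_eq_one_iff_commute.mp h.comm_y
  induction hg using Submonoid.closure_induction_right with
  | one => exact ⟨0, 0, 0, 0, 0, 0, by simp⟩
  | mul_right g _ u hu ih =>
    obtain ⟨a, b, c, d, e, f, rfl⟩ := ih
    rw [mul_assoc _ _ u, ← Subgroup.mem_center_iff.mp (hw e f) u, ← mul_assoc]
    obtain rfl | rfl | rfl | rfl := hu
    · obtain ⟨e₁, f₁, h₁⟩ := hswap (e := 0) (f := 1) (by simpa using h.comm₁₁) c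
      obtain ⟨e₂, f₂, h₂⟩ := hswap (e := 1) (f := 0) (by simpa using h.comm₁₂) d
      refine ⟨a + 1, b, c, d, e₁ + (e₂ + e), f₁ + (f₂ + f), ?_⟩
      rw [hmove (hw _ _) h₁ h₂, ← hmul, ← hmul, mul_assoc (u ^ a), ← (hx₁.pow_right b).eq,
        ← mul_assoc (u ^ a), ← pow_succ, mul_assoc _ (_ * _) (w₁ ^ e * w₂ ^ f),
        mul_assoc (w₁ ^ e₁ * w₂ ^ f₁)]
    · obtain ⟨e₁, f₁, h₁⟩ := hswap (e := 1) (f := 0) (by simpa using h.comm₂₁) c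
      obtain ⟨e₂, f₂, h₂⟩ := hswap (e := 1) (f := 1) (by simpa using h.comm₂₂) d
      refine ⟨a, b + 1, c, d, e₁ + (e₂ + e), f₁ + (f₂ + f), ?_⟩
      rw [hmove (hw _ _) h₁ h₂, ← hmul, ← hmul, mul_assoc (x₁ ^ a), ← pow_succ,
        mul_assoc _ (_ * _) (w₁ ^ e * w₂ ^ f), mul_assoc (w₁ ^ e₁ * w₂ ^ f₁)]
    · refine ⟨a, b, c + 1, d, e, f, ?_⟩
      congr 1
      rw [mul_assoc, ← (hy₁.pow_right d).eq, ← mul_assoc, mul_assoc _ _ u, ← pow_succ]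
    · refine ⟨a, b, c, d + 1, e, f, ?_⟩
      congr 1
      rw [mul_assoc, ← pow_succ]

lemma prod_eq_one (h : SuzukiRelations x₁ x₂ y₁ y₂ w₁ w₂) {a b c d e f : ℕ}
    (he : Even (a + c + e)) (hf : Even (b + d + f)) :
    x₁ ^ (2 * a) * x₂ ^ (2 * b) * y₁ ^ (2 * c) * y₂ ^ (2 * d) * w₁ ^ e * w₂ ^ f = 1 := by
  simp only [pow_mul, h.sq_x₁, h.sq_x₂, h.sq_y₁, h.sq_y₂]
  have hc : ∀ m n : ℕ, w₂ ^ m * w₁ ^ n = w₁ ^ n * w₂ ^ m := fun m n =>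
    Subgroup.mem_center_iff.mp (pow_mem h.center₁ n) _
  have : w₁ ^ a * w₂ ^ b * w₁ ^ c * w₂ ^ d * w₁ ^ e * w₂ ^ f =
      w₁ ^ (a + c + e) * w₂ ^ (b + d + f) := by
    rw [mul_assoc (w₁ ^ a), hc, ← mul_assoc, ← pow_add, mul_assoc _ (w₂ ^ b), ← pow_add,
      mul_assoc (w₁ ^ (a + c)), hc, ← mul_assoc, ← pow_add, mul_assoc, ← pow_add]
  rw [this, pow_eq_one_of_even h.sq_w₁ he, pow_eq_one_of_even h.sq_w₂ hf, one_mul]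

/-- Commutation with `x₁` turns the trivial word into `w₂ ^ c * w₁ ^ d`, and with `y₁` into `w₂ ^ a
* w₁ ^ b`, so these four exponents are even. What remains is a word in `w₁` and `w₂`. Together with
`prod_eq_one`, triviality of a normal form depends on the exponents only. -/
lemma even_of_prod_eq_one (h : SuzukiRelations x₁ x₂ y₁ y₂ w₁ w₂)
    (hi : IndependentInvolutions w₁ w₂) {a b c d e f : ℕ}
    (ht : x₁ ^ a * x₂ ^ b * y₁ ^ c * y₂ ^ d * w₁ ^ e * w₂ ^ f = 1) : ∃ a' b' c' d' : ℕ,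
      a = 2 * a' ∧ b = 2 * b' ∧ c = 2 * c' ∧ d = 2 * d' ∧ Even (a' + c' + e) ∧
      Even (b' + d' + f) := by
  have hz : ∀ {x y w : A}, w ∈ Subgroup.center A → ⁅x, y⁆ = w → ∀ n : ℕ,
      ⁅x, y ^ n⁆ = w ^ n ∧ ⁅x, y ^ n⁆ ∈ Subgroup.center A := by
    rintro x y w hw rfl n
    rw [commutator_pow_right_of_mem_center hw]
    exact ⟨rfl, pow_mem hw n⟩
  have h1 : ∀ {x w : A}, w ∈ Subgroup.center A → ∀ n, ⁅x, w ^ n⁆ = 1 := fun {x w} hw n => by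
    rw [← commutatorElement_inv, mem_center_iff_commutator.mp (pow_mem hw n), inv_one]
  have hexpand : ∀ {x u₁ u₂ u₃ u₄ : A}, u₁ ∈ Subgroup.center A → u₂ ∈ Subgroup.center A →
      u₃ ∈ Subgroup.center A → u₄ ∈ Subgroup.center A → ⁅x, x₁⁆ = u₁ → ⁅x, x₂⁆ = u₂ →
      ⁅x, y₁⁆ = u₃ → ⁅x, y₂⁆ = u₄ → u₁ ^ a * u₂ ^ b * u₃ ^ c * u₄ ^ d = 1 := by
    intro x u₁ u₂ u₃ u₄ c₁ c₂ c₃ c₄ e₁ e₂ e₃ e₄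
    have h2 : ⁅x, x₁ ^ a * x₂ ^ b * y₁ ^ c * y₂ ^ d * w₁ ^ e * w₂ ^ f⁆ = 1 := by
      rw [ht, commutatorElement_one_right]
    rw [commutator_mul_right_of_mem_center (by rw [h1 h.center₂]; exact one_mem _),
      commutator_mul_right_of_mem_center (by rw [h1 h.center₁]; exact one_mem _),
      commutator_mul_right_of_mem_center (hz c₄ e₄ d).2,
      commutator_mul_right_of_mem_center (hz c₃ e₃ c).2,
      commutator_mul_right_of_mem_center (hz c₂ e₂ b).2,
      h1 h.center₂, h1 h.center₁, (hz c₄ e₄ d).1, (hz c₃ e₃ c).1, (hz c₂ e₂ b).1,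
      (hz c₁ e₁ a).1, mul_one, mul_one] at h2
    exact h2
  have hcd := hexpand (one_mem _) (one_mem _) h.center₂ h.center₁ (commutatorElement_self x₁)
    h.comm_x h.comm₁₁ h.comm₁₂
  have hab := hexpand (x := y₁) h.center₂ h.center₁ (one_mem _) (one_mem _)
    (by rw [← commutatorElement_inv, h.comm₁₁, h.inv_w₂])
    (by rw [← commutatorElement_inv, h.comm₂₁, h.inv_w₁]) (commutatorElement_self y₁) h.comm_y
  rw [one_pow, one_pow, one_mul, one_mul, Subgroup.mem_center_iff.mp (pow_mem h.center₁ d)] at hcd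
  rw [one_pow, one_pow, mul_one, mul_one, Subgroup.mem_center_iff.mp (pow_mem h.center₁ b)] at hab
  obtain ⟨hd, hc⟩ := hi.even h.sq_w₁ h.sq_w₂ hcd
  obtain ⟨hb, ha⟩ := hi.even h.sq_w₁ h.sq_w₂ hab
  obtain ⟨a', rfl⟩ := even_iff_two_dvd.mp ha
  obtain ⟨b', rfl⟩ := even_iff_two_dvd.mp hb
  obtain ⟨c', rfl⟩ := even_iff_two_dvd.mp hc
  obtain ⟨d', rfl⟩ := even_iff_two_dvd.mp hd
  refine ⟨a', b', c', d', rfl, rfl, rfl, rfl, hi.even h.sq_w₁ h.sq_w₂ ?_⟩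
  simp only [pow_mul, h.sq_x₁, h.sq_x₂, h.sq_y₁, h.sq_y₂] at ht
  have hc : ∀ m n : ℕ, w₂ ^ m * w₁ ^ n = w₁ ^ n * w₂ ^ m := fun m n =>
    Subgroup.mem_center_iff.mp (pow_mem h.center₁ n) _
  rwa [mul_assoc (w₁ ^ a'), hc, ← mul_assoc, ← pow_add, mul_assoc _ (w₂ ^ b'), ← pow_add,
      mul_assoc (w₁ ^ (a' + c')), hc, ← mul_assoc, ← pow_add, mul_assoc, ← pow_add] at ht

variable {B : Type*} [Group B] {x₁' x₂' y₁' y₂' w₁' w₂' : B}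

lemma prod (h : SuzukiRelations x₁ x₂ y₁ y₂ w₁ w₂)
    (h' : SuzukiRelations x₁' x₂' y₁' y₂' w₁' w₂') :
    SuzukiRelations (x₁, x₁') (x₂, x₂') (y₁, y₁') (y₂, y₂') (w₁, w₁') (w₂, w₂') := by
  have hc : ∀ {w : A} {w' : B}, w ∈ Subgroup.center A → w' ∈ Subgroup.center B →
      (w, w') ∈ Subgroup.center (A × B) := fun hw hw' => by
    rw [Subgroup.mem_center_iff] at *
    exact fun g => Prod.ext (hw g.1) (hw' g.2)
  exact ⟨hc h.center₁ h'.center₁, hc h.center₂ h'.center₂,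
    Prod.ext h.sq_w₁ h'.sq_w₁, Prod.ext h.sq_w₂ h'.sq_w₂,
    Prod.ext h.sq_x₁ h'.sq_x₁, Prod.ext h.sq_x₂ h'.sq_x₂,
    Prod.ext h.sq_y₁ h'.sq_y₁, Prod.ext h.sq_y₂ h'.sq_y₂,
    Prod.ext h.comm_x h'.comm_x, Prod.ext h.comm_y h'.comm_y,
    Prod.ext h.comm₁₁ h'.comm₁₁, Prod.ext h.comm₁₂ h'.comm₁₂,
    Prod.ext h.comm₂₁ h'.comm₂₁, Prod.ext h.comm₂₂ h'.comm₂₂⟩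

/-- A group generated by elements with the given relations is isomorphic to any group that is not
larger and contains such elements. -/
lemma nonempty_mulEquiv [Finite A] [Finite B] (h : SuzukiRelations x₁ x₂ y₁ y₂ w₁ w₂)
    (hi : IndependentInvolutions w₁ w₂) (hgen : Subgroup.closure {x₁, x₂, y₁, y₂} = ⊤)
    (h' : SuzukiRelations x₁' x₂' y₁' y₂' w₁' w₂') (hi' : IndependentInvolutions w₁' w₂')
    (hcard : Nat.card B ≤ Nat.card A) : Nonempty (A ≃* B) := by
  -- `K` will be the graph of the isomorphism. Paired elements satisfy the same relations, so a
  -- normal form is trivial in one coordinate exactly when it is in the other, and both projections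
  -- are injective.
  let K : Subgroup (A × B) := Subgroup.closure {(x₁, x₁'), (x₂, x₂'), (y₁, y₁'), (y₂, y₂')}
  have hprod : ∀ t ∈ K, ∃ a b c d e f : ℕ,
      t.1 = x₁ ^ a * x₂ ^ b * y₁ ^ c * y₂ ^ d * w₁ ^ e * w₂ ^ f ∧
      t.2 = x₁' ^ a * x₂' ^ b * y₁' ^ c * y₂' ^ d * w₁' ^ e * w₂' ^ f := by
    intro t ht
    obtain ⟨a, b, c, d, e, f, rfl⟩ := (h.prod h').exists_eq_prod ht
    exact ⟨a, b, c, d, e, f, rfl, rfl⟩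
  let f₁ : K →* A := (MonoidHom.fst A B).comp K.subtype
  let f₂ : K →* B := (MonoidHom.snd A B).comp K.subtype
  have hinj₁ : Function.Injective f₁ := by
    rw [injective_iff_map_eq_one]
    rintro ⟨t, ht⟩ (ht1 : t.1 = 1)
    obtain ⟨a, b, c, d, e, f, h1, h2⟩ := hprod t ht
    rw [h1] at ht1
    obtain ⟨a, b, c, d, rfl, rfl, rfl, rfl, he, hf⟩ := h.even_of_prod_eq_one hi ht1
    exact Subtype.ext (Prod.ext (h1.trans ht1) (h2.trans (h'.prod_eq_one he hf)))
  have hinj₂ : Function.Injective f₂ := by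
    rw [injective_iff_map_eq_one]
    rintro ⟨t, ht⟩ (ht1 : t.2 = 1)
    obtain ⟨a, b, c, d, e, f, h1, h2⟩ := hprod t ht
    rw [h2] at ht1
    obtain ⟨a, b, c, d, rfl, rfl, rfl, rfl, he, hf⟩ := h'.even_of_prod_eq_one hi' ht1
    exact Subtype.ext (Prod.ext (h1.trans (h.prod_eq_one he hf)) (h2.trans ht1))
  have hsurj₁ : Function.Surjective f₁ := by
    rw [← MonoidHom.range_eq_top, ← top_le_iff, ← hgen, Subgroup.closure_le]
    have hmem : ∀ t : A × B, t ∈ ({(x₁, x₁'), (x₂, x₂'), (y₁, y₁'), (y₂, y₂')} : Set (A × B)) →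
        t.1 ∈ f₁.range := fun t ht => ⟨⟨t, Subgroup.subset_closure ht⟩, rfl⟩
    rintro _ (rfl | rfl | rfl | rfl)
    · exact hmem (_, x₁') (by simp)
    · exact hmem (_, x₂') (by simp)
    · exact hmem (_, y₁') (by simp)
    · exact hmem (_, y₂') (by simp)
  have e₁ : K ≃* A := MulEquiv.ofBijective f₁ ⟨hinj₁, hsurj₁⟩
  have e₂ : K ≃* B := MulEquiv.ofBijective f₂
    (hinj₂.bijective_of_nat_card_le (hcard.trans (Nat.card_congr e₁.toEquiv).ge))
  exact ⟨e₁.symm.trans e₂⟩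

end SuzukiRelations

/-! ### Suzuki generators when the centre has order four. -/

namespace SquareCentral

variable {G : Type*} [Group G]

lemma commutator_eq_one_of_mem_centralizer {x g : G} (hg : g ∈ Subgroup.centralizer {x}) :
    ⁅x, g⁆ = 1 :=
  commutatorElement_eq_one_iff_mul_comm.mpr (Subgroup.mem_centralizer_singleton_iff.mp hg).symm

lemma mem_centralizer_of_commutator_eq_one {x g : G} (hg : ⁅x, g⁆ = 1) :
    g ∈ Subgroup.centralizer {x} :=
  Subgroup.mem_centralizer_singleton_iff.mpr (commutatorElement_eq_one_iff_mul_comm.mp hg).symm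

/-- The centralizers of noncentral elements are abelian if they have order `16`. -/
lemma centralizer_eq [Finite G] (h : SquareCentral G) (hZ : Nat.card (Subgroup.center G) = 4)
    {x y : G} (hx : x ∉ Subgroup.center G) (hy : y ∉ Subgroup.center G)
    (hxy : ⁅x, y⁆ = 1) : Subgroup.centralizer {x} = Subgroup.centralizer {y} := by
  by_cases hc : x⁻¹ * y ∈ Subgroup.center G
  · ext g
    have e : y = x * (x⁻¹ * y) := by group
    rw [← ker_commutatorHom x (h.commutator_mem x), ← ker_commutatorHom y (h.commutator_mem y),
      MonoidHom.mem_ker, MonoidHom.mem_ker, commutatorHom_apply, commutatorHom_apply, e,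
      commutator_mul_center_left hc]
  · have hcx : Nat.card (Subgroup.centralizer {x}) = 16 := by rw [(h.card_eq hx).1, hZ]; rfl
    have hcy : Nat.card (Subgroup.centralizer {y}) = 16 := by rw [(h.card_eq hy).1, hZ]; rfl
    set B := Subgroup.centralizer {x} ⊓ Subgroup.centralizer {y} with hB
    have hB16 : Nat.card B ∣ 16 := hcx ▸ Subgroup.card_dvd_of_le inf_le_left
    have hcen : ∀ c ∈ Subgroup.center G, c ∈ B := fun c hc' =>
      ⟨Subgroup.center_le_centralizer _ hc', Subgroup.center_le_centralizer _ hc'⟩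
    have hxB : x ∈ B := ⟨mem_centralizer_of_commutator_eq_one (commutatorElement_self x),
      mem_centralizer_of_commutator_eq_one (by rw [← commutatorElement_inv, hxy, inv_one])⟩
    have hyB : y ∈ B := ⟨mem_centralizer_of_commutator_eq_one hxy,
      mem_centralizer_of_commutator_eq_one (commutatorElement_self y)⟩
    -- `B` contains the three distinct cosets `Z`, `x * Z` and `y * Z`; a divisor of `16` that is at
    -- least `12` is `16`.
    have hB12 : 12 ≤ Nat.card B := by
      have e : Nat.card ((Subgroup.center G ⊕ Subgroup.center G) ⊕ Subgroup.center G) = 12 := by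
        rw [Nat.card_sum, Nat.card_sum, hZ]
      rw [← e]
      refine Nat.card_le_card_of_injective (Sum.elim (Sum.elim (fun c => ⟨c, hcen c c.2⟩)
        (fun c => ⟨x * c, mul_mem hxB (hcen c c.2)⟩))
        (fun c => ⟨y * c, mul_mem hyB (hcen c c.2)⟩)) ?_
      refine Function.Injective.sumElim (Function.Injective.sumElim ?_ ?_ ?_) ?_ ?_
      · exact fun a b hab => Subtype.ext (congrArg (Subtype.val : B → G) hab)
      · exact fun a b hab => Subtype.ext (mul_left_cancel (congrArg (Subtype.val : B → G) hab))
      · intro a b hab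
        have hab' : (a : G) = x * b := congrArg (Subtype.val : B → G) hab
        exact hx ((Subgroup.mul_mem_cancel_right _ b.2).mp (hab' ▸ a.2))
      · exact fun a b hab => Subtype.ext (mul_left_cancel (congrArg (Subtype.val : B → G) hab))
      · rintro (a | a) b hab
        · have hab' : (a : G) = y * b := congrArg (Subtype.val : B → G) hab
          exact hy ((Subgroup.mul_mem_cancel_right _ b.2).mp (hab' ▸ a.2))
        · have hab' : x * (a : G) = y * b := congrArg (Subtype.val : B → G) hab
          refine hc ?_
          have : x⁻¹ * y = a * (b : G)⁻¹ := by
            rw [eq_mul_inv_iff_mul_eq, mul_assoc, ← hab', inv_mul_cancel_left]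
          exact this ▸ mul_mem a.2 (inv_mem b.2)
    have hBc : Nat.card B = 16 := by
      have := Nat.le_of_dvd (by norm_num) hB16
      interval_cases Nat.card B <;> omega
    have h1 : B = Subgroup.centralizer {x} :=
      Subgroup.eq_of_le_of_card_ge inf_le_left (by rw [hBc, hcx])
    have h2 : B = Subgroup.centralizer {y} :=
      Subgroup.eq_of_le_of_card_ge inf_le_right (by rw [hBc, hcy])
    rw [← h1, ← h2]

lemma eq_of_mem_center (h : SquareCentral G) (hZ : Nat.card (Subgroup.center G) = 4)
    {u v w : G} (hu : u ∈ Subgroup.center G) (hv : v ∈ Subgroup.center G) (hu1 : u ≠ 1)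
    (hv1 : v ≠ 1) (huv : u ≠ v) (hw : w ∈ Subgroup.center G) :
    w = 1 ∨ w = u ∨ w = v ∨ w = u * v := by
  classical
  have : Finite (Subgroup.center G) := Nat.finite_of_card_ne_zero (by omega)
  have := Fintype.ofFinite (Subgroup.center G)
  let s : Finset (Subgroup.center G) := {1, ⟨u, hu⟩, ⟨v, hv⟩, ⟨u * v, mul_mem hu hv⟩}
  have hs : s = Finset.univ := by
    rw [← Finset.card_eq_iff_eq_univ, ← Nat.card_eq_fintype_card, hZ]
    have h1 : u * v ≠ 1 := fun h1 => huv (by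
      rw [eq_inv_of_mul_eq_one_left h1, inv_eq_of_mul_eq_one_right (h.mul_self_of_mem hv)])
    rw [Finset.card_insert_of_notMem, Finset.card_insert_of_notMem, Finset.card_pair]
    · simp [Subtype.ext_iff, hu1]
    · simp [Subtype.ext_iff, huv, hv1]
    · simp [Subtype.ext_iff, hu1.symm, hv1.symm, h1.symm]
  have hws : (⟨w, hw⟩ : Subgroup.center G) ∈ s := hs ▸ Finset.mem_univ _
  simpa [s, Subtype.ext_iff] using hws

lemma exists_centralizer_sq_eq [Finite G] (h : SquareCentral G)
    (hZ : Nat.card (Subgroup.center G) = 4) {x u : G} (hx : x ∉ Subgroup.center G)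
    (hu : u ∈ Subgroup.center G) (hu1 : u ≠ 1) (hux : u ≠ x ^ 2) :
    ∃ y, ⁅x, y⁆ = 1 ∧ y ^ 2 = u := by
  -- The centralizer has `16` elements, while `Z` and `x * Z` account for `8`. Depending on its
  -- square, `y` or `x * y` is the required root.
  obtain ⟨y, hy, hyZ, hyx⟩ : ∃ y, ⁅x, y⁆ = 1 ∧ y ∉ Subgroup.center G ∧
      x⁻¹ * y ∉ Subgroup.center G := by
    by_contra! hall
    have hcx : Nat.card (Subgroup.centralizer {x}) = 16 := by rw [(h.card_eq hx).1, hZ]; rfl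
    classical
    let f : Subgroup.centralizer {x} →
        {g : G // g ∈ Subgroup.center G} ⊕ {g : G // x⁻¹ * g ∈ Subgroup.center G} := fun y =>
      if hyZ : (y : G) ∈ Subgroup.center G then Sum.inl ⟨y, hyZ⟩
      else Sum.inr ⟨y, hall y (commutator_eq_one_of_mem_centralizer y.2) hyZ⟩
    have hle := Nat.card_le_card_of_injective f (by
      intro a b hab
      simp only [f] at hab
      split_ifs at hab with h1 h2 h2
      · exact Subtype.ext (by simpa using hab)
      · exact Subtype.ext (by simpa using hab))
    have e2 : Nat.card {g : G // x⁻¹ * g ∈ Subgroup.center G} = 4 := by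
      rw [← hZ]
      exact Nat.card_congr ((Equiv.mulLeft x⁻¹).subtypeEquiv fun g => Iff.rfl)
    have e1 : Nat.card {g : G // g ∈ Subgroup.center G} = 4 := hZ
    rw [Nat.card_sum, e1, e2, hcx] at hle
    omega
  have hy1 := h.sq_ne_one hyZ
  have hxy2 : (x * y) ^ 2 = x ^ 2 * y ^ 2 := by rw [h.mul_sq, hy, mul_one]
  rcases h.eq_of_mem_center hZ (h.sq_mem x) hu (h.sq_ne_one hx) hu1 hux.symm (h.sq_mem y) with
    h1 | h1 | h1 | h1
  · exact absurd h1 hy1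
  · exfalso
    rw [h1, h.mul_self_of_mem (h.sq_mem x), ← h.mem_center_iff] at hxy2
    refine hyx ?_
    have e : x⁻¹ * y = (x ^ 2)⁻¹ * (x * y) := by group
    rw [e]
    exact mul_mem (inv_mem (h.sq_mem x)) hxy2
  · exact ⟨y, hy, h1⟩
  · refine ⟨x * y, by rw [h.commutator_mul_right, commutatorElement_self, hy, one_mul], ?_⟩
    rw [hxy2, h1, ← mul_assoc, h.mul_self_of_mem (h.sq_mem x), one_mul]

lemma exists_suzukiRelations [Finite G] (h : SquareCentral G)
    (hZ : Nat.card (Subgroup.center G) = 4)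
    (hQ : ∀ x g : G, x ∉ Subgroup.center G → ⁅x, g⁆ = x ^ 2 → g ^ 2 ≠ x ^ 2) :
    ∃ x₁ x₂ y₁ y₂ w₁ w₂ : G, SuzukiRelations x₁ x₂ y₁ y₂ w₁ w₂ ∧ IndependentInvolutions w₁ w₂ ∧
      Subgroup.closure {x₁, x₂, y₁, y₂} = ⊤ := by
  obtain ⟨x₁, hx₁⟩ := h.exists_notMem
  -- There are `20` roots of `x₁ ^ 2` but only `16` elements in the centralizer of `x₁`.
  obtain ⟨y₁, hy₁, hxy⟩ : ∃ y, y ^ 2 = x₁ ^ 2 ∧ ⁅x₁, y⁆ ≠ 1 := by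
    by_contra! hall
    have hle := Nat.card_le_card_of_injective (α := {y : G // y ^ 2 = x₁ ^ 2})
      (β := Subgroup.centralizer {x₁})
      (fun y => ⟨y, mem_centralizer_of_commutator_eq_one (hall y y.2)⟩)
      (fun a b hab => Subtype.ext (congrArg (Subtype.val : Subgroup.centralizer {x₁} → G) hab))
    rw [(h.card_eq hx₁).1, (h.card_eq hx₁).2, hZ] at hle
    omega
  have hne : ∀ {y : G}, y ^ 2 ≠ 1 → y ∉ Subgroup.center G := fun hy hyZ =>
    hy ((h.mem_center_iff _).mp hyZ)
  have hy₁Z : y₁ ∉ Subgroup.center G := hne (hy₁ ▸ h.sq_ne_one hx₁)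
  have hw₁ : x₁ ^ 2 ≠ 1 := h.sq_ne_one hx₁
  have hw₁c : x₁ ^ 2 ∈ Subgroup.center G := h.sq_mem x₁
  obtain ⟨w₁, hw₁x⟩ : ∃ w₁, w₁ = x₁ ^ 2 := ⟨_, rfl⟩
  obtain ⟨w₂, hw₂⟩ : ∃ w₂, w₂ = ⁅x₁, y₁⁆ := ⟨_, rfl⟩
  have hw₂c : w₂ ∈ Subgroup.center G := hw₂ ▸ h.commutator_mem x₁ y₁
  have hw₂w₁ : w₂ ≠ w₁ := by
    rintro he
    exact hQ x₁ y₁ hx₁ (by rw [← hw₂, he, hw₁x]) hy₁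
  rw [← hw₂] at hxy
  obtain ⟨x₂, hxx, hx₂⟩ := h.exists_centralizer_sq_eq hZ hx₁ hw₂c hxy (by rwa [← hw₁x])
  obtain ⟨y₂, hyy, hy₂⟩ := h.exists_centralizer_sq_eq hZ hy₁Z hw₂c hxy (by rwa [hy₁, ← hw₁x])
  have hx₂Z : x₂ ∉ Subgroup.center G := hne (hx₂ ▸ hxy)
  have hy₂Z : y₂ ∉ Subgroup.center G := hne (hy₂ ▸ hxy)
  rw [← hw₁x] at hw₁ hw₁c hy₁
  have hcases := fun w => h.eq_of_mem_center hZ (w := w) hw₁c hw₂c hw₁ hxy hw₂w₁.symm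
  have h1 : w₁ * w₁ = 1 := h.mul_self_of_mem hw₁c
  have h2 : w₂ * w₂ = 1 := h.mul_self_of_mem hw₂c
  have h12 : w₁ * w₂ ≠ 1 := fun he => hw₂w₁ (by
    rw [eq_inv_of_mul_eq_one_left he, inv_eq_of_mul_eq_one_right h2])
  -- Commuting is transitive on noncentral elements, so commuting `X` and `Y` would make `x₁` and
  -- `y₁` commute.
  have hnd : ∀ X Y : G, X ∉ Subgroup.center G → Y ∉ Subgroup.center G → ⁅x₁, X⁆ = 1 →
      ⁅y₁, Y⁆ = 1 → ⁅X, Y⁆ ≠ 1 := by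
    intro X Y hX hY h3 h4 h5
    have e1 := h.centralizer_eq hZ hx₁ hX h3
    have e2 := h.centralizer_eq hZ hX hY h5
    have e3 := h.centralizer_eq hZ hy₁Z hY h4
    have h6 : y₁ ∈ Subgroup.centralizer {x₁} := by
      rw [e1, e2, ← e3]
      exact mem_centralizer_of_commutator_eq_one (commutatorElement_self _)
    exact hxy (hw₂ ▸ commutator_eq_one_of_mem_centralizer h6)
  have hnd2 : ∀ X Y : G, X ∉ Subgroup.center G → Y ∉ Subgroup.center G → ⁅x₁, X⁆ = 1 →
      ⁅y₁, Y⁆ = 1 → ⁅X, Y⁆ ≠ X ^ 2 * Y ^ 2 := by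
    intro X Y hX hY h3 h4 h5
    have h6 : X * Y ∈ Subgroup.center G := by
      rw [h.mem_center_iff, h.mul_sq, h5]
      exact h.mul_self_of_mem (mul_mem (h.sq_mem X) (h.sq_mem Y))
    refine hnd X Y hX hY h3 h4 ?_
    have h7 : ⁅X, X * Y⁆ = 1 := by
      rw [h.commutator_comm, mem_center_iff_commutator.mp h6]
    rwa [h.commutator_mul_right, commutatorElement_self, one_mul] at h7
  have hyy2 : y₁ * y₂ ∉ Subgroup.center G := hne (by rwa [h.mul_sq, hyy, mul_one, hy₁, hy₂])
  have hxx2 : x₁ * x₂ ∉ Subgroup.center G := hne (by rwa [h.mul_sq, hxx, mul_one, ← hw₁x, hx₂])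
  have hyy' : ⁅y₁, y₁ * y₂⁆ = 1 := by
    rw [h.commutator_mul_right, commutatorElement_self, hyy, one_mul]
  have hxx' : ⁅x₁, x₁ * x₂⁆ = 1 := by
    rw [h.commutator_mul_right, commutatorElement_self, hxx, one_mul]
  -- Each remaining commutator is found by excluding three of the four central values. Here `1` and
  -- `w₂` would make `x₁` commute with `y₂` or `y₁ * y₂`, and `w₁ * w₂` is `x₁ ^ 2 * y₂ ^ 2`.
  have h₁₂ : ⁅x₁, y₂⁆ = w₁ := by
    rcases hcases _ (h.commutator_mem x₁ y₂) with h3 | h3 | h3 | h3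
    · exact absurd h3 (hnd _ _ hx₁ hy₂Z (commutatorElement_self _) hyy)
    · exact h3
    · refine absurd ?_ (hnd x₁ _ hx₁ hyy2 (commutatorElement_self _) hyy')
      rw [h.commutator_mul_right, ← hw₂, h3, h2]
    · refine absurd ?_ (hnd2 x₁ _ hx₁ hy₂Z (commutatorElement_self _) hyy)
      rw [h3, ← hw₁x, hy₂]
  have h₂₁ : ⁅x₂, y₁⁆ = w₁ := by
    rcases hcases _ (h.commutator_mem x₂ y₁) with h3 | h3 | h3 | h3
    · exact absurd h3 (hnd _ _ hx₂Z hy₁Z hxx (commutatorElement_self _))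
    · exact h3
    · refine absurd ?_ (hnd _ y₁ hxx2 hy₁Z hxx' (commutatorElement_self _))
      rw [h.commutator_mul_left, ← hw₂, h3, h2]
    · refine absurd ?_ (hnd2 _ _ hx₂Z hy₁Z hxx (commutatorElement_self _))
      rw [h3, hx₂, hy₁, Subgroup.mem_center_iff.mp hw₂c]
  have h₂₂ : ⁅x₂, y₂⁆ = w₁ * w₂ := by
    rcases hcases _ (h.commutator_mem x₂ y₂) with h3 | h3 | h3 | h3
    · exact absurd h3 (hnd _ _ hx₂Z hy₂Z hxx hyy)
    · refine absurd ?_ (hnd x₂ _ hx₂Z hyy2 hxx hyy')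
      rw [h.commutator_mul_right, h₂₁, h3, h1]
    · exact absurd (hy₂.trans hx₂.symm) (hQ x₂ y₂ hx₂Z (h3.trans hx₂.symm))
    · exact h3
  refine ⟨x₁, x₂, y₁, y₂, w₁, w₂, ⟨hw₁c, hw₂c, by rw [sq, h1], by rw [sq, h2], hw₁x.symm, hx₂, hy₁,
    hy₂, hxx, hyy, hw₂.symm, h₁₂, h₂₁, h₂₂⟩, ⟨hw₁, hxy, h12⟩, ?_⟩
  set L := Subgroup.closure {x₁, x₂, y₁, y₂}
  have hx₁L : x₁ ∈ L := Subgroup.subset_closure (by simp)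
  have hx₂L : x₂ ∈ L := Subgroup.subset_closure (by simp)
  have hy₁L : y₁ ∈ L := Subgroup.subset_closure (by simp)
  have hy₂L : y₂ ∈ L := Subgroup.subset_closure (by simp)
  have hZL : ∀ w ∈ Subgroup.center G, w ∈ L := by
    intro w hw
    have hw₁L : w₁ ∈ L := hw₁x ▸ pow_mem hx₁L 2
    have hw₂L : w₂ ∈ L := hx₂ ▸ pow_mem hx₂L 2
    rcases hcases w hw with rfl | rfl | rfl | rfl
    · exact one_mem _
    · exact hw₁L
    · exact hw₂L
    · exact mul_mem hw₁L hw₂L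
  -- The quotient `g * X⁻¹` commutes with `x₁` and `y₁`. It is central, because `hnd` applied to it
  -- twice would deny that it commutes with itself.
  have hmod : ∀ g X : G, X ∈ L → ⁅x₁, X⁆ = 1 → ⁅x₁, g⁆ = 1 → ⁅y₁, g⁆ = ⁅y₁, X⁆ → g ∈ L := by
    intro g X hX h3 h4 h5
    rw [← Subgroup.mul_mem_cancel_right L (inv_mem hX)]
    refine hZL _ ?_
    by_contra hgX
    refine hnd _ _ hgX hgX ?_ ?_ (commutatorElement_self _)
    · rw [h.commutator_mul_right, commutator_inv_right_of_mem_center (h.commutator_mem _ _), h3,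
        h4, inv_one, one_mul]
    · rw [h.commutator_mul_right, commutator_inv_right_of_mem_center (h.commutator_mem _ _), h5,
        mul_inv_cancel]
  have hCL : ∀ g, ⁅x₁, g⁆ = 1 → g ∈ L := by
    intro g hg
    rcases hcases _ (h.commutator_mem y₁ g) with h3 | h3 | h3 | h3
    · exact hmod g 1 (one_mem _) (commutatorElement_one_right _) hg
        (by rw [h3, commutatorElement_one_right])
    · exact hmod g x₂ hx₂L hxx hg (by rw [h3, h.commutator_comm, h₂₁])
    · exact hmod g x₁ hx₁L (commutatorElement_self _) hg (by rw [h3, h.commutator_comm, hw₂])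
    · refine hmod g (x₁ * x₂) (mul_mem hx₁L hx₂L) hxx' hg ?_
      rw [h3, h.commutator_mul_right, h.commutator_comm y₁, h.commutator_comm y₁, ← hw₂, h₂₁,
        Subgroup.mem_center_iff.mp hw₂c]
  have hmod2 : ∀ g Y : G, Y ∈ L → ⁅x₁, g⁆ = ⁅x₁, Y⁆ → g ∈ L := by
    intro g Y hY hg
    rw [← Subgroup.mul_mem_cancel_right L (inv_mem hY)]
    refine hCL _ ?_
    rw [h.commutator_mul_right, commutator_inv_right_of_mem_center (h.commutator_mem _ _), hg,
      mul_inv_cancel]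
  rw [eq_top_iff]
  rintro g -
  rcases hcases _ (h.commutator_mem x₁ g) with h3 | h3 | h3 | h3
  · exact hCL g h3
  · exact hmod2 g y₂ hy₂L (h3.trans h₁₂.symm)
  · exact hmod2 g y₁ hy₁L (h3.trans hw₂)
  · refine hmod2 g (y₂ * y₁) (mul_mem hy₂L hy₁L) ?_
    rw [h3, h.commutator_mul_right, h₁₂, ← hw₂]

end SquareCentral

/-! ### The Suzuki relations inside `G64`. -/

section Field16

lemma conjF16_apply (a : F16) : conjF16 a = a ^ 4 := by
  simp [conjF16, iterateFrobenius_def]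

lemma F16.pow_sixteen (a : F16) : a ^ 16 = a := by
  have : Fintype F16 := Fintype.ofFinite _
  have h := FiniteField.pow_card a
  rwa [← Nat.card_eq_fintype_card, GaloisField.card 2 4 (by norm_num)] at h

lemma F16.two_eq_zero : (2 : F16) = 0 := CharTwo.two_eq_zero

lemma F16.add_pow_four (a b : F16) : (a + b) ^ 4 = a ^ 4 + b ^ 4 := by
  have := add_pow_char_pow a b (p := 2) (n := 2)
  simpa using this

/-- The matrix with rows `(1, a, b)`, `(0, 1, a ^ 4)`, `(0, 0, 1)`. -/
noncomputable def suzukiMatrix (a b : F16) : Matrix.SpecialLinearGroup (Fin 3) F16 :=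
  ⟨!![1, a, b; 0, 1, a ^ 4; 0, 0, 1], by simp [Matrix.det_fin_three]⟩

lemma suzukiMatrix_mem {a b : F16} (h : b + b ^ 4 = a ^ 5) :
    suzukiMatrix a b ∈ SU34 ⊓ unitriangular3 := by
  have h2 := F16.two_eq_zero
  have h16 := F16.pow_sixteen a
  refine ⟨?_, ?_, ?_⟩
  · change ((suzukiMatrix a b).1.map conjF16).transpose * gramJ * (suzukiMatrix a b).1 = gramJ
    ext i j
    fin_cases i <;> fin_cases j <;>
      simp [suzukiMatrix, gramJ, Matrix.mul_apply, Fin.sum_univ_three, conjF16_apply, -mul_eq_zero]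
    · linear_combination a ^ 4 * h2
    · linear_combination a * h2 + h16
    · linear_combination h + a ^ 5 * h2 + a ^ 4 * h16
  · intro i
    fin_cases i <;> simp [suzukiMatrix]
  · intro i j hij
    fin_cases i <;> fin_cases j <;> simp_all [suzukiMatrix]

lemma eq_suzukiMatrix {A : Matrix.SpecialLinearGroup (Fin 3) F16}
    (hA : A ∈ SU34 ⊓ unitriangular3) :
    A = suzukiMatrix (A 0 1) (A 0 2) ∧ A 0 2 + A 0 2 ^ 4 = A 0 1 ^ 5 := by
  obtain ⟨hU, hd, hl⟩ := hA
  have h2 := F16.two_eq_zero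
  have h16 := F16.pow_sixteen (A 0 1)
  change (A.1.map conjF16).transpose * gramJ * A.1 = gramJ at hU
  have h10 : A 1 0 = 0 := hl 1 0 (by decide)
  have h20 : A 2 0 = 0 := hl 2 0 (by decide)
  have h21 : A 2 1 = 0 := hl 2 1 (by decide)
  have e12 := congrFun (congrFun hU 1) 2
  have e22 := congrFun (congrFun hU 2) 2
  simp [gramJ, Matrix.mul_apply, Fin.sum_univ_three, conjF16_apply, hd, h21, -mul_eq_zero] at e12 e22
  have h12 : A 1 2 = A 0 1 ^ 4 := by linear_combination e12 - A 0 1 ^ 4 * h2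
  refine ⟨?_, ?_⟩
  · ext i j
    fin_cases i <;> fin_cases j <;> simp [suzukiMatrix, hd, h10, h20, h21, h12]
  · rw [h12] at e22
    linear_combination e22 - A 0 1 ^ 4 * h16 - A 0 1 ^ 5 * h2

lemma suzukiMatrix_mul (a b a' b' : F16) :
    suzukiMatrix a b * suzukiMatrix a' b' = suzukiMatrix (a + a') (b' + a * a' ^ 4 + b) := by
  refine Subtype.ext ?_
  change (suzukiMatrix a b).1 * (suzukiMatrix a' b').1 = _
  ext i j
  fin_cases i <;> fin_cases j <;>
    simp [suzukiMatrix, Matrix.mul_apply, Fin.sum_univ_three, F16.add_pow_four, add_comm]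

lemma suzukiMatrix_inj {a b a' b' : F16} (h : suzukiMatrix a b = suzukiMatrix a' b') :
    a = a' ∧ b = b' := by
  have h1 := congrArg (fun A => A.1 0 1) h
  have h2 := congrArg (fun A => A.1 0 2) h
  exact ⟨by simpa [suzukiMatrix] using h1, by simpa [suzukiMatrix] using h2⟩

lemma suzukiMatrix_zero : suzukiMatrix 0 0 = 1 := by
  ext i j
  fin_cases i <;> fin_cases j <;> simp [suzukiMatrix]

/-- The elements of `G64`. -/
noncomputable def suzukiElement (a b : F16) (h : b + b ^ 4 = a ^ 5) : G64 :=
  ⟨suzukiMatrix a b, suzukiMatrix_mem h⟩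

lemma suzukiElement_sq {a b c : F16} (h : b + b ^ 4 = a ^ 5) (h' : c + c ^ 4 = 0 ^ 5)
    (hc : a ^ 5 = c) : suzukiElement a b h ^ 2 = suzukiElement 0 c h' := by
  refine Subtype.ext ?_
  change suzukiMatrix a b ^ 2 = suzukiMatrix 0 c
  have h2 := F16.two_eq_zero
  rw [sq, suzukiMatrix_mul]
  congr 1
  · linear_combination a * h2
  · linear_combination b * h2 + hc

lemma suzukiElement_commutator {a b a' b' c : F16} (h : b + b ^ 4 = a ^ 5)
    (h' : b' + b' ^ 4 = a' ^ 5) (h'' : c + c ^ 4 = 0 ^ 5) (hc : a * a' ^ 4 + a' * a ^ 4 = c) :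
    ⁅suzukiElement a b h, suzukiElement a' b' h'⁆ = suzukiElement 0 c h'' := by
  rw [commutatorElement_def, mul_inv_eq_iff_eq_mul, mul_inv_eq_iff_eq_mul]
  refine Subtype.ext ?_
  change suzukiMatrix a b * suzukiMatrix a' b' =
    suzukiMatrix 0 c * suzukiMatrix a' b' * suzukiMatrix a b
  have h2 := F16.two_eq_zero
  simp only [suzukiMatrix_mul]
  congr 1
  · ring
  · linear_combination hc - a' * a ^ 4 * h2

lemma suzukiElement_eq_one {b : F16} (h : b + b ^ 4 = 0 ^ 5) (h1 : suzukiElement 0 b h = 1) :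
    b = 0 := by
  have h2 : suzukiMatrix 0 b = suzukiMatrix 0 0 :=
    (congrArg Subtype.val h1).trans suzukiMatrix_zero.symm
  exact (suzukiMatrix_inj h2).2

lemma suzukiElement_mem_center {b : F16} (h : b + b ^ 4 = 0 ^ 5) :
    suzukiElement 0 b h ∈ Subgroup.center G64 := by
  rw [Subgroup.mem_center_iff]
  rintro ⟨A, hA⟩
  refine Subtype.ext ?_
  change A * suzukiMatrix 0 b = suzukiMatrix 0 b * A
  rw [(eq_suzukiMatrix hA).1, suzukiMatrix_mul, suzukiMatrix_mul]
  congr 1 <;> ring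

/-- For each `a` the quartic equation for `b` has at most four roots. The upper bound suffices,
since `nonempty_mulEquiv` only needs the target not to be larger. -/
lemma card_G64_le : Nat.card G64 ≤ 64 := by
  classical
  have : Fintype F16 := Fintype.ofFinite _
  have hF : Fintype.card F16 = 16 := by
    rw [← Nat.card_eq_fintype_card, GaloisField.card 2 4 (by norm_num)]
    norm_num
  have hfib : ∀ a : F16, Nat.card {b : F16 // b + b ^ 4 = a ^ 5} ≤ 4 := by
    intro a
    have hdeg : (Polynomial.X ^ 4 + (Polynomial.X - Polynomial.C (a ^ 5)) :
        Polynomial F16).natDegree = 4 := by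
      compute_degree!
    have hne : (Polynomial.X ^ 4 + (Polynomial.X - Polynomial.C (a ^ 5)) :
        Polynomial F16) ≠ 0 := by
      intro h0
      rw [h0, Polynomial.natDegree_zero] at hdeg
      omega
    rw [Nat.card_eq_fintype_card, Fintype.card_subtype]
    refine le_trans (Finset.card_le_card ?_) ((Multiset.toFinset_card_le _).trans
      ((Polynomial.card_roots' _).trans hdeg.le))
    intro b hb
    have hb' := (Finset.mem_filter.mp hb).2
    rw [Multiset.mem_toFinset, Polynomial.mem_roots hne]
    simp only [Polynomial.IsRoot.def, Polynomial.eval_add, Polynomial.eval_sub,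
      Polynomial.eval_pow, Polynomial.eval_X, Polynomial.eval_C]
    linear_combination hb'
  calc Nat.card G64 ≤ Nat.card (Σ a : F16, {b : F16 // b + b ^ 4 = a ^ 5}) := by
        refine Nat.card_le_card_of_injective
          (fun A : G64 => ⟨A.1 0 1, A.1 0 2, (eq_suzukiMatrix A.2).2⟩) ?_
        intro A B hAB
        have h1 : A.1 0 1 = B.1 0 1 := congrArg Sigma.fst hAB
        have h2 : A.1 0 2 = B.1 0 2 := congrArg (fun t => (t.2 : F16)) hAB
        refine Subtype.ext ?_
        rw [(eq_suzukiMatrix A.2).1, (eq_suzukiMatrix B.2).1, h1, h2]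
    _ ≤ ∑ _a : F16, 4 := by
        rw [Nat.card_sigma]
        exact Finset.sum_le_sum fun a _ => hfib a
    _ = 64 := by rw [Finset.sum_const, Finset.card_univ, hF]; rfl

lemma F16.exists_fifth_root : ∃ η : F16, 1 + η + η ^ 2 + η ^ 3 + η ^ 4 = 0 := by
  have hcard : Nat.card F16ˣ = 15 := by
    rw [Nat.card_units, GaloisField.card 2 4 (by norm_num)]
    norm_num
  have : Fact (Nat.Prime 5) := ⟨by norm_num⟩
  obtain ⟨u, hu⟩ := exists_prime_orderOf_dvd_card' (G := F16ˣ) 5 (by rw [hcard]; norm_num)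
  have h5 : (u : F16) ^ 5 = 1 := by
    have := pow_orderOf_eq_one u
    rw [hu] at this
    rw [← Units.val_pow_eq_pow_val, this, Units.val_one]
  have h1 : (u : F16) - 1 ≠ 0 := by
    intro h0
    have : u = 1 := Units.ext (sub_eq_zero.mp h0)
    rw [this, orderOf_one] at hu
    omega
  refine ⟨u, mul_left_cancel₀ h1 ?_⟩
  linear_combination h5

/-- With `η` a primitive fifth root of unity, `ω = η ^ 2 + η ^ 3` is a primitive cube root of unity,
hence generates the subfield of order four. The last equation says that `η` has trace `ω + 1` over
that subfield. -/
lemma F16.exists_generators : ∃ η ω : F16, η ^ 5 = 1 ∧ ω ^ 2 = ω + 1 ∧ ω ^ 4 = ω ∧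
    η ^ 4 = ω + 1 + η := by
  obtain ⟨η, h⟩ := F16.exists_fifth_root
  have h2 := F16.two_eq_zero
  have h5 : η ^ 5 = 1 := by linear_combination (η - 1) * h
  obtain ⟨ω, hω⟩ : ∃ ω : F16, ω = η ^ 2 + η ^ 3 := ⟨_, rfl⟩
  have hω2 : ω ^ 2 = ω + 1 := by grind
  refine ⟨η, ω, h5, hω2, ?_, ?_⟩
  · linear_combination (ω ^ 2 + ω + 2) * hω2 + (ω + 1) * h2
  · linear_combination h - (ω + 1 + η) * h2 + hω

lemma exists_suzukiRelations_G64 : ∃ x₁ x₂ y₁ y₂ w₁ w₂ : G64,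
    SuzukiRelations x₁ x₂ y₁ y₂ w₁ w₂ ∧ IndependentInvolutions w₁ w₂ := by
  obtain ⟨η, ω, h5, hω2, hω4, hη4⟩ := F16.exists_generators
  have h2 := F16.two_eq_zero
  have hωη : ω * η + (ω * η) ^ 4 = 1 := by grind
  have hω5 : ω ^ 5 = ω + 1 := by linear_combination ω * hω4 + hω2
  have hωη5 : (ω * η) ^ 5 = ω + 1 := by rw [mul_pow, hω5, h5, mul_one]
  have hη : η + η ^ 4 = ω ^ 5 := by linear_combination hη4 - hω5 + η * h2
  have b0 : (0 : F16) + 0 ^ 4 = 0 ^ 5 := by ring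
  have bw₁ : (1 : F16) + 1 ^ 4 = 0 ^ 5 := by linear_combination h2
  have bw₂ : (ω + 1) + (ω + 1) ^ 4 = 0 ^ 5 := by
    rw [F16.add_pow_four, hω4]
    linear_combination (ω + 1) * h2
  have bw : ω + ω ^ 4 = 0 ^ 5 := by rw [hω4]; linear_combination ω * h2
  have cx : 1 * ω ^ 4 + ω * 1 ^ 4 = 0 := by linear_combination hω4 + ω * h2
  have cy : η * (ω * η) ^ 4 + ω * η * η ^ 4 = 0 := by
    linear_combination η ^ 5 * hω4 + ω * η ^ 5 * h2
  have c₁₁ : 1 * η ^ 4 + η * 1 ^ 4 = ω + 1 := by linear_combination hη4 + η * h2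
  have c₁₂ : 1 * (ω * η) ^ 4 + ω * η * 1 ^ 4 = 1 := by linear_combination hωη
  have c₂₁ : ω * η ^ 4 + η * ω ^ 4 = 1 := by
    linear_combination ω * hη4 + η * hω4 + hω2 + (ω + ω * η) * h2
  have c₂₂ : ω * (ω * η) ^ 4 + ω * η * ω ^ 4 = ω := by
    linear_combination ω * hωη + ω * η * hω4
  have e₁ : (1 : F16) ^ 5 = 1 := one_pow 5
  -- The second entry only has to have trace `a ^ 5` over the field of order four: `ω * η` has trace
  -- `1 = 1 ^ 5 = η ^ 5`, and `η` has trace `ω + 1 = ω ^ 5 = (ω * η) ^ 5`.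
  let x₁ := suzukiElement 1 (ω * η) (hωη.trans e₁.symm)
  let x₂ := suzukiElement ω η hη
  let y₁ := suzukiElement η (ω * η) (hωη.trans h5.symm)
  let y₂ := suzukiElement (ω * η) η (hη.trans (hω5.trans hωη5.symm))
  let w₁ := suzukiElement 0 1 bw₁
  let w₂ := suzukiElement 0 (ω + 1) bw₂
  have hone : suzukiElement 0 0 b0 = 1 := Subtype.ext suzukiMatrix_zero
  have hww : w₁ * w₂ = suzukiElement 0 ω bw := by
    refine Subtype.ext ?_
    change suzukiMatrix _ _ * suzukiMatrix _ _ = suzukiMatrix _ _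
    rw [suzukiMatrix_mul]
    congr 1
    linear_combination h2
  have hω0 : ω ≠ 0 := by
    rintro rfl
    simp at hω2
  have hω1 : ω + 1 ≠ 0 := by
    intro h0
    rw [h0] at hω2
    exact hω0 (by simpa using hω2)
  have z5 : (0 : F16) ^ 5 = 0 := zero_pow (by norm_num)
  exact ⟨x₁, x₂, y₁, y₂, w₁, w₂,
    { center₁ := suzukiElement_mem_center bw₁
      center₂ := suzukiElement_mem_center bw₂
      sq_w₁ := (suzukiElement_sq bw₁ b0 z5).trans hone
      sq_w₂ := (suzukiElement_sq bw₂ b0 z5).trans hone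
      sq_x₁ := suzukiElement_sq _ bw₁ e₁
      sq_x₂ := suzukiElement_sq _ bw₂ hω5
      sq_y₁ := suzukiElement_sq _ bw₁ h5
      sq_y₂ := suzukiElement_sq _ bw₂ hωη5
      comm_x := (suzukiElement_commutator _ _ b0 cx).trans hone
      comm_y := (suzukiElement_commutator _ _ b0 cy).trans hone
      comm₁₁ := suzukiElement_commutator _ _ bw₂ c₁₁
      comm₁₂ := suzukiElement_commutator _ _ bw₁ c₁₂
      comm₂₁ := suzukiElement_commutator _ _ bw₁ c₂₁
      comm₂₂ := (suzukiElement_commutator _ _ bw c₂₂).trans hww.symm },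
    { ne₁ := fun h1 => one_ne_zero (suzukiElement_eq_one bw₁ h1)
      ne₂ := fun h1 => hω1 (suzukiElement_eq_one bw₂ h1)
      ne := fun h1 => hω0 (suzukiElement_eq_one bw (hww.symm.trans h1)) }⟩

end Field16

theorem theorem4p10 (p : ℕ) [Fact p.Prime] (G : Type*) [Group G] [Finite G]
    (hp : IsPGroup p G) (hreg : IsTupleRegular 2 G) :
    IsHomocyclic p G ∨ Nonempty (G ≃* QuaternionGroup 2) ∨ Nonempty (G ≃* G64) := by
  obtain ⟨k, hZ, x, hx⟩ := hp.exists_mem_center_iff hreg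
  by_cases hG : Subgroup.center G = ⊤
  · refine Or.inl (isHomocyclic_of_commute hreg (fun a b => ?_) (k := k) (fun g => ?_) ⟨x, hx⟩)
    · exact Subgroup.mem_center_iff.mp (hG ▸ Subgroup.mem_top b : b ∈ Subgroup.center G) a
    · exact (hZ g).mp (hG ▸ Subgroup.mem_top g)
  right
  have h := hp.centralLayer hreg hZ hG
  obtain ⟨rfl, rfl⟩ := h.eq_two_and_eq_one hp
  have hs := h.squareCentral hp
  rcases hs.card_center hp with h2 | ⟨h4, hQ⟩
  · exact Or.inl (hs.mulEquiv_quaternionGroup h2)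
  · right
    obtain ⟨x₁, x₂, y₁, y₂, w₁, w₂, hrel, hind, hgen⟩ := hs.exists_suzukiRelations h4 hQ
    obtain ⟨x₁', x₂', y₁', y₂', w₁', w₂', hrel', hind'⟩ := exists_suzukiRelations_G64
    exact hrel.nonempty_mulEquiv hind hgen hrel' hind'
      (card_G64_le.trans (by rw [hs.card_eq_pow_three, h4]; norm_num))
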